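/- Let $\mathcal{E}$ be an exact category in the sense of Quillen, let $d\geq 1$ be an integer, and let $\mathcal{U}$ be a full subcategory of $\mathcal{E}$ closed under finite direct sums (in particular containing a zero object). A complex in $\mathcal{E}$ is called exact if it is spliced from conflations, i.e. there are conflations $0\to Z_i\to X_i\to Z_{i-1}\to 0$ such that each differential $X_i\to X_{i-1}$ is the composite $X_i\to Z_{i-1}\to X_{i-1}$. Two exact sequences $0\to Y\to E_n\to\cdots\to E_1\to X\to 0$ and $0\to Y\to E'_n\to\cdots\to E'_1\to X\to 0$ are Yoneda equivalent if there is a third exact sequence with the same end terms which admits morphisms to both of them that are the identity on $X$ and $Y$; for $n\geq 1$, $\operatorname{Ext}^n_{\mathcal{E}}(X,Y)$ is the group of Yoneda equivalence classes of such sequences. Assume that $\mathcal{U}$ is $d$-extension closed in $\mathcal{E}$, that is: (i) $\mathcal{U}$ is $d$-rigid: $\operatorname{Ext}^i_{\mathcal{E}}(U,U')=0$ for all $U,U'\in\mathcal{U}$ and $0<i<d$; and (ii) every exact sequence $0\to U\to E_1\to\cdots\to E_d\to U'\to 0$ in $\mathcal{E}$ with $U,U'\in\mathcal{U}$ is Yoneda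 equivalent to an exact sequence $0\to U\to U_1\to\cdots\to U_d\to U'\to 0$ with $U_i\in\mathcal{U}$ for all $1\leq i\leq d$. For a full subcategory $\mathcal{E}'\subseteq\mathcal{E}$, endowed with the conflations of $\mathcal{E}$ all of whose terms lie in $\mathcal{E}'$, put $$\mathcal{U}^d(\mathcal{E}')=\{E\in\mathcal{E}'\mid \exists\ 0\to E\to U^1\to\cdots\to U^d\to 0\text{ exact in }\mathcal{E}',\ U^i\in\mathcal{U}\text{ for }1\leq i\leq d\},$$ $$\mathcal{U}_d(\mathcal{E}')=\{E\in\mathcal{E}'\mid \exists\ 0\to U_d\to\cdots\to U_1\to E\to 0\text{ exact in }\mathcal{E}',\ U_i\in\mathcal{U}\text{ for }1\leq i\leq d\}.$$ Then, as subcategories of $\mathcal{E}$, $$\mathcal{U}_d(\mathcal{U}^d(\mathcal{E}))=\mathcal{U}^d(\mathcal{U}_d(\mathcal{E})).$$ -/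

import Mathlib

open CategoryTheory CategoryTheory.Limits

universe v u

/-- A conflation structure: a class of kernel-cokernel pairs, closed under isomorphism.
The members of the class are called conflations. -/
structure ConflationStructure (C : Type u) [Category.{v} C] [Preadditive C] where
  /-- the class of conflations -/
  IsConflation : ShortComplex C → Prop
  isKernel : ∀ S : ShortComplex C, IsConflation S → Nonempty (IsLimit (KernelFork.ofι S.f S.zero))
  isCokernel : ∀ S : ShortComplex C, IsConflation S →
    Nonempty (IsColimit (CokernelCofork.ofπ S.g S.zero))
  of_iso : ∀ S T : ShortComplex C, Nonempty (S ≅ T) → IsConflation S → IsConflation T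

namespace ConflationStructure

variable {C : Type u} [Category.{v} C] [Preadditive C] (E : ConflationStructure C)

/-- Inflations: the kernel parts of conflations. -/
def IsInflation {X Y : C} (i : X ⟶ Y) : Prop :=
  ∃ (Z : C) (p : Y ⟶ Z) (w : i ≫ p = 0), E.IsConflation (ShortComplex.mk i p w)

/-- Deflations: the cokernel parts of conflations. -/
def IsDeflation {Y Z : C} (p : Y ⟶ Z) : Prop :=
  ∃ (X : C) (i : X ⟶ Y) (w : i ≫ p = 0), E.IsConflation (ShortComplex.mk i p w)

/-- The conflation structure induced on a full subcategory: its conflations are the conflations of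
the ambient category all of whose terms lie in the subcategory. If the ambient structure is exact
and the subcategory is closed under extensions (and contains a zero object), this is the inherited
exact structure. -/
def restrict (P : ObjectProperty C) : ConflationStructure P.FullSubcategory where
  IsConflation S := E.IsConflation
    (ShortComplex.mk S.f.hom S.g.hom (congrArg (fun t => t.hom) S.zero))
  isKernel S hS := by
    obtain ⟨h⟩ := E.isKernel _ hS
    refine ⟨KernelFork.IsLimit.ofι _ _
      (fun g hg => ObjectProperty.homMk
        (h.lift (KernelFork.ofι g.hom (congrArg (fun t => t.hom) hg)))) ?_ ?_⟩
    · intro W g hg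
      ext
      exact h.fac (KernelFork.ofι g.hom (congrArg (fun t => t.hom) hg)) WalkingParallelPair.zero
    · intro W g hg m hm
      ext
      refine Fork.IsLimit.hom_ext h ?_
      refine Eq.trans (congrArg (fun t => t.hom) hm) ?_
      exact (h.fac (KernelFork.ofι g.hom (congrArg (fun t => t.hom) hg))
        WalkingParallelPair.zero).symm
  isCokernel S hS := by
    obtain ⟨h⟩ := E.isCokernel _ hS
    refine ⟨CokernelCofork.IsColimit.ofπ _ _
      (fun g hg => ObjectProperty.homMk
        (h.desc (CokernelCofork.ofπ g.hom (congrArg (fun t => t.hom) hg)))) ?_ ?_⟩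
    · intro W g hg
      ext
      exact h.fac (CokernelCofork.ofπ g.hom (congrArg (fun t => t.hom) hg))
        WalkingParallelPair.one
    · intro W g hg m hm
      ext
      refine Cofork.IsColimit.hom_ext h ?_
      refine Eq.trans (congrArg (fun t => t.hom) hm) ?_
      exact (h.fac (CokernelCofork.ofπ g.hom (congrArg (fun t => t.hom) hg))
        WalkingParallelPair.one).symm
  of_iso S T e hS := by
    obtain ⟨e⟩ := e
    refine E.of_iso _ _ ⟨ShortComplex.isoMk
      (P.ι.mapIso (ShortComplex.π₁.mapIso e)) (P.ι.mapIso (ShortComplex.π₂.mapIso e))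
      (P.ι.mapIso (ShortComplex.π₃.mapIso e)) ?_ ?_⟩ hS
    · exact congrArg (fun t => t.hom) e.hom.comm₁₂
    · exact congrArg (fun t => t.hom) e.hom.comm₂₃

/-- A sequence `F₀ ⟶ F₁ ⟶ ⋯ ⟶ Fₙ` is exact (also at both ends, i.e. the complex
`0 ⟶ F₀ ⟶ ⋯ ⟶ Fₙ ⟶ 0` is acyclic) if there are conflations `0 ⟶ Zᵢ ⟶ Fᵢ ⟶ Zᵢ₊₁ ⟶ 0` for
`0 ≤ i ≤ n`, with `Z₀` and `Zₙ₊₁` zero, such that each `Fᵢ ⟶ Fᵢ₊₁` is the composite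
`Fᵢ ⟶ Zᵢ₊₁ ⟶ Fᵢ₊₁`. -/
def IsAcyclic {n : ℕ} (F : ComposableArrows C n) : Prop :=
  ∃ (Z : Fin (n + 2) → C) (i : ∀ k : Fin (n + 1), Z k.castSucc ⟶ F.obj k)
    (p : ∀ k : Fin (n + 1), F.obj k ⟶ Z k.succ),
    IsZero (Z 0) ∧ IsZero (Z (Fin.last (n + 1))) ∧
    (∀ k : Fin (n + 1), ∃ w : i k ≫ p k = 0, E.IsConflation (ShortComplex.mk (i k) (p k) w)) ∧
    ∀ k : Fin n, F.map (homOfLE k.castSucc_le_succ) = p k.castSucc ≫ i k.succ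

/-- An exact sequence `0 ⟶ Y ⟶ Eₙ ⟶ ⋯ ⟶ E₁ ⟶ X ⟶ 0` with `n` middle terms. The middle
terms are `seq.obj k.succ.castSucc` for `k : Fin n`. -/
structure Extension (n : ℕ) (X Y : C) where
  seq : ComposableArrows C (n + 1)
  isAcyclic : E.IsAcyclic seq
  leftIso : seq.left ≅ Y
  rightIso : seq.right ≅ X

variable {E} in
/-- A morphism of exact sequences which is the identity on both end terms. -/
def Extension.IsMorphism {n : ℕ} {X Y : C} (S T : E.Extension n X Y) (φ : S.seq ⟶ T.seq) : Prop :=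
  φ.app 0 ≫ T.leftIso.hom = S.leftIso.hom ∧
    φ.app (Fin.last (n + 1)) ≫ T.rightIso.hom = S.rightIso.hom

variable {E} in
/-- Yoneda equivalence of exact sequences with the same end terms: there is an exact sequence `R`
with the same end terms and morphisms `S ⟵ R ⟶ T` which are the identity on the end terms. -/
def Extension.YonedaEquiv {n : ℕ} {X Y : C} (S T : E.Extension n X Y) : Prop :=
  ∃ (R : E.Extension n X Y) (φ : R.seq ⟶ S.seq) (ψ : R.seq ⟶ T.seq),
    R.IsMorphism S φ ∧ R.IsMorphism T ψ

/-- `Extⁿ(X, Y) = 0` for `n > 0`: there is only one Yoneda equivalence class of exact sequences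
`0 ⟶ Y ⟶ Eₙ ⟶ ⋯ ⟶ E₁ ⟶ X ⟶ 0`. -/
def ExtVanishes (n : ℕ) (X Y : C) : Prop :=
  ∀ S T : E.Extension n X Y, S.YonedaEquiv T

/-- `U` is `d`-rigid: `Extⁱ(X, Y) = 0` for all `0 < i < d` and `X, Y ∈ U`. -/
def IsRigid (d : ℕ) (U : ObjectProperty C) : Prop :=
  ∀ i : ℕ, 0 < i → i < d → ∀ X Y : C, U X → U Y → E.ExtVanishes i X Y

/-- `U` is `d`-extension closed: it is `d`-rigid, and every exact sequence
`0 ⟶ Y ⟶ E₁ ⟶ ⋯ ⟶ E_d ⟶ X ⟶ 0` with `X, Y ∈ U` is Yoneda equivalent to one all of whose middle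
terms lie in `U`. -/
def IsExtensionClosed (d : ℕ) (U : ObjectProperty C) : Prop :=
  E.IsRigid d U ∧
    ∀ X Y : C, U X → U Y → ∀ S : E.Extension d X Y,
      ∃ T : E.Extension d X Y, S.YonedaEquiv T ∧ ∀ k : Fin d, U (T.seq.obj k.succ.castSucc)

/-- The objects `X` admitting an exact sequence `0 ⟶ X ⟶ U¹ ⟶ ⋯ ⟶ Uʲ ⟶ 0` with all `Uⁱ ∈ U`. -/
def coresolved (U : ObjectProperty C) (j : ℕ) : ObjectProperty C := fun X =>
  ∃ F : ComposableArrows C j, E.IsAcyclic F ∧ F.left = X ∧ ∀ k : Fin j, U (F.obj k.succ)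

/-- The objects `X` admitting an exact sequence `0 ⟶ U_j ⟶ ⋯ ⟶ U_1 ⟶ X ⟶ 0` with all `U_i ∈ U`. -/
def resolved (U : ObjectProperty C) (j : ℕ) : ObjectProperty C := fun X =>
  ∃ F : ComposableArrows C j, E.IsAcyclic F ∧ F.right = X ∧ ∀ k : Fin j, U (F.obj k.castSucc)

/-- `coresolved`, formed inside the full subcategory `P` with its induced conflations, and regarded
as a class of objects of the ambient category. -/
def coresolvedIn (P U : ObjectProperty C) (j : ℕ) : ObjectProperty C :=
  ((E.restrict P).coresolved (U.inverseImage P.ι) j).strictMap P.ι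

/-- `resolved`, formed inside the full subcategory `P` with its induced conflations, and regarded
as a class of objects of the ambient category. -/
def resolvedIn (P U : ObjectProperty C) (j : ℕ) : ObjectProperty C :=
  ((E.restrict P).resolved (U.inverseImage P.ι) j).strictMap P.ι

end ConflationStructure

/-- An exact structure in the sense of Quillen. -/
structure ExactStructure (C : Type u) [Category.{v} C] [Preadditive C] extends
    ConflationStructure C where
  id_inflation : ∀ X : C, toConflationStructure.IsInflation (𝟙 X)
  id_deflation : ∀ X : C, toConflationStructure.IsDeflation (𝟙 X)
  comp_inflation : ∀ {X Y Z : C} (f : X ⟶ Y) (g : Y ⟶ Z), toConflationStructure.IsInflation f →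
    toConflationStructure.IsInflation g → toConflationStructure.IsInflation (f ≫ g)
  comp_deflation : ∀ {X Y Z : C} (f : X ⟶ Y) (g : Y ⟶ Z), toConflationStructure.IsDeflation f →
    toConflationStructure.IsDeflation g → toConflationStructure.IsDeflation (f ≫ g)
  pullback_deflation : ∀ {X Y Z : C} (p : X ⟶ Z) (f : Y ⟶ Z), toConflationStructure.IsDeflation p →
    ∃ (W : C) (f' : W ⟶ X) (p' : W ⟶ Y), IsPullback f' p' p f ∧
      toConflationStructure.IsDeflation p'
  pushout_inflation : ∀ {X Y Z : C} (i : X ⟶ Y) (f : X ⟶ Z), toConflationStructure.IsInflation i →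
    ∃ (W : C) (f' : Y ⟶ W) (i' : Z ⟶ W), IsPushout i f f' i' ∧
      toConflationStructure.IsInflation i'

/-- A full subcategory, given by its class `U` of objects, is closed under finite direct sums: it
contains a zero object, and a direct sum of any two of its objects. -/
def IsClosedUnderDirectSums {C : Type u} [Category.{v} C] [Preadditive C] [HasBinaryBiproducts C]
    (U : ObjectProperty C) : Prop :=
  (∃ Z : C, IsZero Z ∧ U Z) ∧ ∀ X Y : C, U X → U Y → ∃ W : C, U W ∧ Nonempty (W ≅ X ⊞ Y)

/-! Rigidity is used in the form `SplitsBelow`: a conflation `V ⟶ M ⟶ Z` with `V` in `U` splits if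
`Z` has a `U`-coresolution of length `j < d`, and dually. This is dimension shifting. For a
conflation `Z ⟶ W ⟶ Z'` with `W` in `U`, the group `Extⁿ⁺¹(Z, V)` sits between `Extⁿ⁺¹(W, V)` and
`Extⁿ⁺²(Z', V)`, so its vanishing follows by induction on the length of the coresolution
(`splitsBelow_of_leftVanishes`). The exactness used here is proved by hand on Yoneda extensions.

Given splitting, let `X` be in `U_d(U^d)` and induct along its resolution. The last conflation is `A
⟶ B ⟶ X` with `B` in `U`, and by induction `A` is in `U^d(U_d)`, say through `A ⟶ V ⟶ A'`. The
pushout `Q` of `B` and `V` under `A` is an extension of `A'` by `B`, hence `Q ≅ B ⊞ A'`; it is also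
an extension of `X` by `V`. So `X` is the cokernel of an inflation `V ⟶ Q`, where `Q` has a good
coresolution of length `d - 1`. Now `coresIn_of_conf` walks along the given coresolution of `X`. It
repeats the pushout trick at each cosyzygy and shows each to be the cokernel of an inflation from an
object with a short resolution, so that `res_of_conf` puts it in `U_d`.

The other inclusion is the same argument in the opposite category. -/

/-! ### Conflations and duality -/

namespace ConflationStructure

variable {C : Type u} [Category.{v} C] [Preadditive C] (E : ConflationStructure C)

/-- The pair `(i, p)` is a conflation `0 ⟶ X ⟶ Y ⟶ Z ⟶ 0`. -/
def Conf {X Y Z : C} (i : X ⟶ Y) (p : Y ⟶ Z) : Prop :=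
  ∃ w : i ≫ p = 0, E.IsConflation (ShortComplex.mk i p w)

/-- The opposite conflation structure. -/
def opposite : ConflationStructure Cᵒᵖ where
  IsConflation S := E.IsConflation S.unop
  isKernel S hS := by
    obtain ⟨h⟩ := E.isCokernel _ hS
    exact ⟨CokernelCofork.IsColimit.ofπOp _ S.unop.zero h⟩
  isCokernel S hS := by
    obtain ⟨h⟩ := E.isKernel _ hS
    exact ⟨KernelFork.IsLimit.ofιOp _ S.unop.zero h⟩
  of_iso S T e hS := by
    obtain ⟨e⟩ := e
    exact E.of_iso _ _ ⟨((ShortComplex.unopFunctor C).mapIso e).unop.symm⟩ hS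

lemma conf_opposite_iff {X Y Z : Cᵒᵖ} (i : X ⟶ Y) (p : Y ⟶ Z) :
    E.opposite.Conf i p ↔ E.Conf p.unop i.unop :=
  ⟨fun ⟨w, h⟩ => ⟨by rw [← unop_comp, w, unop_zero], h⟩,
    fun ⟨w, h⟩ => ⟨Quiver.Hom.unop_inj (by simpa using w), h⟩⟩

variable {E}

namespace Conf

variable {X Y Z : C} {i : X ⟶ Y} {p : Y ⟶ Z}

lemma op (h : E.Conf i p) : E.opposite.Conf p.op i.op :=
  (E.conf_opposite_iff _ _).2 h

lemma unop {X Y Z : Cᵒᵖ} {i : X ⟶ Y} {p : Y ⟶ Z} (h : E.opposite.Conf i p) :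
    E.Conf p.unop i.unop :=
  (E.conf_opposite_iff _ _).1 h

lemma zero (h : E.Conf i p) : i ≫ p = 0 := h.1

lemma mono (h : E.Conf i p) : Mono i := by
  obtain ⟨w, h⟩ := h
  obtain ⟨hl⟩ := E.isKernel _ h
  exact ⟨fun a b hab => Fork.IsLimit.hom_ext hl hab⟩

lemma epi (h : E.Conf i p) : Epi p := by
  have := h.op.mono
  exact unop_epi_of_mono p.op

lemma lift (h : E.Conf i p) {W : C} (f : W ⟶ Y) (hf : f ≫ p = 0) : ∃ g : W ⟶ X, g ≫ i = f := by
  obtain ⟨w, h⟩ := h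
  obtain ⟨hl⟩ := E.isKernel _ h
  exact ⟨hl.lift (KernelFork.ofι f hf), hl.fac (KernelFork.ofι f hf) WalkingParallelPair.zero⟩

lemma desc (h : E.Conf i p) {W : C} (f : Y ⟶ W) (hf : i ≫ f = 0) : ∃ g : Z ⟶ W, p ≫ g = f := by
  obtain ⟨g, hg⟩ := h.op.lift f.op (by rw [← op_comp, hf, op_zero])
  exact ⟨g.unop, Quiver.Hom.op_inj (by simpa using hg)⟩

lemma of_iso (h : E.Conf i p) {X' Y' Z' : C} {i' : X' ⟶ Y'} {p' : Y' ⟶ Z'} (a : X ≅ X')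
    (b : Y ≅ Y') (c : Z ≅ Z') (hi : i ≫ b.hom = a.hom ≫ i') (hp : p ≫ c.hom = b.hom ≫ p') :
    E.Conf i' p' := by
  have w' : i' ≫ p' = 0 := by
    rw [← cancel_epi a.hom, ← reassoc_of% hi, ← hp, reassoc_of% h.zero]; simp
  obtain ⟨w, h⟩ := h
  exact ⟨w', E.of_iso _ _ ⟨ShortComplex.isoMk a b c hi.symm hp.symm⟩ h⟩

lemma of_iso_left (h : E.Conf i p) {X' : C} (a : X' ≅ X) : E.Conf (a.hom ≫ i) p :=
  h.of_iso a.symm (Iso.refl _) (Iso.refl _) (by simp) (by simp)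

lemma of_iso_right (h : E.Conf i p) {Z' : C} (c : Z ≅ Z') : E.Conf i (p ≫ c.hom) :=
  h.of_iso (Iso.refl _) (Iso.refl _) c (by simp) (by simp)

lemma isIso_right (h : E.Conf i p) (hX : IsZero X) : IsIso p := by
  have hi : i = 0 := hX.eq_of_src _ _
  obtain ⟨g, hg⟩ := h.desc (𝟙 Y) (by simp [hi])
  have := h.epi
  exact ⟨g, hg, by rw [← cancel_epi p, reassoc_of% hg]; simp⟩

lemma isIso_left (h : E.Conf i p) (hZ : IsZero Z) : IsIso i := by
  have hp : p = 0 := hZ.eq_of_tgt _ _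
  obtain ⟨g, hg⟩ := h.lift (𝟙 Y) (by simp [hp])
  have := h.mono
  exact ⟨g, by rw [← cancel_mono i, Category.assoc, hg]; simp, hg⟩

/-- If `i'` is a kernel of the deflation `p`, then `(i', p)` is a conflation. -/
lemma of_isKernel (h : E.Conf i p) {X' : C} (i' : X' ⟶ Y) [Mono i'] (w : i' ≫ p = 0)
    (hl : ∃ t : X ⟶ X', t ≫ i' = i) : E.Conf i' p := by
  obtain ⟨t, ht⟩ := hl
  obtain ⟨s, hs⟩ := h.lift i' w
  have := h.mono
  refine h.of_iso ⟨t, s, ?_, ?_⟩ (Iso.refl _) (Iso.refl _) (by simp [ht]) (by simp)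
  · rw [← cancel_mono i]; simp [hs, ht]
  · rw [← cancel_mono i']; simp [hs, ht]

end Conf

end ConflationStructure

/-! ### Pullbacks, pushouts and sums of conflations -/

namespace ExactStructure

variable {C : Type u} [Category.{v} C] [Preadditive C] (E : ExactStructure C)

/-- The opposite exact structure. -/
def opposite : ExactStructure Cᵒᵖ where
  toConflationStructure := E.toConflationStructure.opposite
  id_inflation X := by
    obtain ⟨Z, p, h⟩ := E.id_deflation X.unop
    exact ⟨_, p.op, ConflationStructure.Conf.op (E := E.toConflationStructure) h⟩
  id_deflation X := by
    obtain ⟨Z, p, h⟩ := E.id_inflation X.unop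
    exact ⟨_, p.op, ConflationStructure.Conf.op (E := E.toConflationStructure) h⟩
  comp_inflation f g hf hg := by
    obtain ⟨_, p, hf⟩ := hf
    obtain ⟨_, q, hg⟩ := hg
    obtain ⟨Z, r, h⟩ := E.comp_deflation g.unop f.unop
      ⟨_, q.unop, ConflationStructure.Conf.unop (E := E.toConflationStructure) hg⟩
      ⟨_, p.unop, ConflationStructure.Conf.unop (E := E.toConflationStructure) hf⟩
    exact ⟨_, r.op, ConflationStructure.Conf.op (E := E.toConflationStructure) h⟩
  comp_deflation f g hf hg := by
    obtain ⟨_, p, hf⟩ := hf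
    obtain ⟨_, q, hg⟩ := hg
    obtain ⟨Z, r, h⟩ := E.comp_inflation g.unop f.unop
      ⟨_, q.unop, ConflationStructure.Conf.unop (E := E.toConflationStructure) hg⟩
      ⟨_, p.unop, ConflationStructure.Conf.unop (E := E.toConflationStructure) hf⟩
    exact ⟨_, r.op, ConflationStructure.Conf.op (E := E.toConflationStructure) h⟩
  pullback_deflation p f hp := by
    obtain ⟨_, i, hp⟩ := hp
    obtain ⟨W, f', p', sq, Z, r, h⟩ := E.pushout_inflation p.unop f.unop
      ⟨_, i.unop, ConflationStructure.Conf.unop (E := E.toConflationStructure) hp⟩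
    exact ⟨_, f'.op, p'.op, sq.op.flip, _, r.op,
      ConflationStructure.Conf.op (E := E.toConflationStructure) h⟩
  pushout_inflation p f hp := by
    obtain ⟨_, i, hp⟩ := hp
    obtain ⟨W, f', p', sq, Z, r, h⟩ := E.pullback_deflation p.unop f.unop
      ⟨_, i.unop, ConflationStructure.Conf.unop (E := E.toConflationStructure) hp⟩
    exact ⟨_, f'.op, p'.op, sq.op.flip, _, r.op,
      ConflationStructure.Conf.op (E := E.toConflationStructure) h⟩

variable {E}

/-- The pullback of a conflation along a morphism to its cokernel. -/
lemma pullback_conf {X Y Z Z' : C} {i : X ⟶ Y} {p : Y ⟶ Z} (h : E.Conf i p) (f : Z' ⟶ Z) :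
    ∃ (Y' : C) (i' : X ⟶ Y') (p' : Y' ⟶ Z') (b : Y' ⟶ Y),
      E.Conf i' p' ∧ i' ≫ b = i ∧ IsPullback b p' p f := by
  obtain ⟨Y', b, p', sq, X', j, h'⟩ := E.pullback_deflation p f ⟨X, i, h⟩
  have h' : E.Conf j p' := h'
  have hw : i ≫ p = 0 ≫ f := by simp [h.zero]
  refine ⟨Y', sq.lift i 0 hw, p', b, ?_, by simp, sq⟩
  have := h.mono
  have hm : Mono (sq.lift i 0 hw) := by
    refine ⟨fun a c hac => ?_⟩
    rw [← cancel_mono i]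
    simpa using congrArg (· ≫ b) hac
  refine h'.of_isKernel _ (by simp) ?_
  obtain ⟨t, ht⟩ := h.lift (j ≫ b) (by rw [Category.assoc, sq.w, reassoc_of% h'.zero, zero_comp])
  exact ⟨t, sq.hom_ext (by simp [ht]) (by simp [h'.zero])⟩

/-- The pushout of a conflation along a morphism from its kernel. -/
lemma pushout_conf {X Y Z X' : C} {i : X ⟶ Y} {p : Y ⟶ Z} (h : E.Conf i p) (f : X ⟶ X') :
    ∃ (Y' : C) (i' : X' ⟶ Y') (p' : Y' ⟶ Z) (b : Y ⟶ Y'),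
      E.Conf i' p' ∧ b ≫ p' = p ∧ IsPushout i f b i' := by
  obtain ⟨Y', i', p', b, h', w, sq⟩ := pullback_conf (E := E.opposite) h.op f.op
  exact ⟨_, p'.unop, i'.unop, b.unop, h'.unop, Quiver.Hom.op_inj w, sq.unop.flip⟩

/-- Composition of a deflation with the cokernel of a conflation. -/
lemma conf_comp {K Q X Q' Q₁ : C} {i : K ⟶ Q} {p : Q ⟶ X} (h : E.Conf i p)
    {j : Q' ⟶ Q₁} {q : Q₁ ⟶ Q} (h' : E.Conf j q) :
    ∃ (P : C) (a : P ⟶ Q₁) (j' : Q' ⟶ P) (q' : P ⟶ K),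
      E.Conf a (q ≫ p) ∧ E.Conf j' q' ∧ j' ≫ a = j ∧ IsPullback a q' q i := by
  obtain ⟨P, j', q', a, hc, w, sq⟩ := pullback_conf h' i
  refine ⟨P, a, j', q', ?_, hc, w, sq⟩
  obtain ⟨P₀, a₀, h₀⟩ := E.comp_deflation q p ⟨_, _, h'⟩ ⟨_, _, h⟩
  have h₀ : E.Conf a₀ (q ≫ p) := h₀
  have := h.mono
  have : Mono a := ⟨fun x y hxy => sq.hom_ext hxy (by
    rw [← cancel_mono i, Category.assoc, Category.assoc, ← sq.w, reassoc_of% hxy])⟩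
  refine h₀.of_isKernel a (by rw [reassoc_of% sq.w, h.zero, comp_zero]) ?_
  obtain ⟨t, ht⟩ := h.lift (a₀ ≫ q) (by rw [Category.assoc, h₀.zero])
  exact ⟨sq.lift a₀ t ht.symm, by simp⟩

/-- Composition of an inflation with the kernel of a conflation. -/
lemma comp_conf {A B X B₁ F : C} {i : A ⟶ B} {p : B ⟶ X} (h : E.Conf i p)
    {j : B ⟶ B₁} {q : B₁ ⟶ F} (h' : E.Conf j q) :
    ∃ (P : C) (a : B₁ ⟶ P) (j' : X ⟶ P) (q' : P ⟶ F),
      E.Conf (i ≫ j) a ∧ E.Conf j' q' ∧ a ≫ q' = q ∧ IsPushout j p a j' := by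
  obtain ⟨P, a, q', j', h₁, h₂, w, sq⟩ := conf_comp (E := E.opposite) h.op h'.op
  exact ⟨_, a.unop, j'.unop, q'.unop, h₁.unop, h₂.unop, Quiver.Hom.op_inj w, sq.unop.flip⟩

/-- The pushout of two inflations. -/
lemma pushout_two_conf {X V X' K A : C} {i : X ⟶ V} {p : V ⟶ X'} (h : E.Conf i p)
    {j : X ⟶ K} {q : K ⟶ A} (h' : E.Conf j q) :
    ∃ (Q : C) (a : V ⟶ Q) (b : Q ⟶ A) (c : K ⟶ Q) (e : Q ⟶ X'), E.Conf a b ∧ E.Conf c e := by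
  obtain ⟨Q, c, e, a, h₁, w, sq⟩ := pushout_conf h j
  have := h'.epi
  obtain ⟨b, hab⟩ : ∃ b : Q ⟶ A, a ≫ b = 0 ∧ c ≫ b = q :=
    ⟨sq.desc 0 q (by simp [h'.zero]), by simp, by simp⟩
  obtain ⟨Q₂, a₂, b₂, c₂, h₂, w₂, sq₂⟩ := pushout_conf h' i
  let φ := sq.isoIsPushout _ _ sq₂.flip
  refine ⟨Q, a, b, c, e, h₂.of_iso (Iso.refl _) φ.symm (Iso.refl _) ?_ ?_, h₁⟩
  · simp [φ]
  · have h0 : a₂ ≫ b₂ = 0 := h₂.zero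
    rw [Iso.symm_hom, Iso.refl_hom, Category.comp_id, Iso.eq_inv_comp]
    refine sq.hom_ext ?_ ?_
    · simp [φ, hab.1, h0]
    · simp [φ, hab.2, w₂]

/-- The short five lemma for the middle term of a morphism of conflations with identical ends. -/
lemma isIso_of_conf {Y W W' Q : C} {i : Y ⟶ W} {p : W ⟶ Q} (h : E.Conf i p)
    {i' : Y ⟶ W'} {p' : W' ⟶ Q} (h' : E.Conf i' p') (f : W ⟶ W') (hi : i ≫ f = i')
    (hp : f ≫ p' = p) : IsIso f := by
  obtain ⟨P, j, r, b, hc, w, sq⟩ := pullback_conf h p'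
  have := h'.mono
  have := hc.epi
  have hmono : Mono f := by
    refine Preadditive.mono_of_cancel_zero _ fun x hx => ?_
    obtain ⟨y, hy⟩ := h.lift x (by rw [← hp, reassoc_of% hx, zero_comp])
    have : y = 0 := by
      rw [← cancel_mono i', zero_comp, ← hi, reassoc_of% hy, hx]
    rw [← hy, this, zero_comp]
  -- On the pullback of `W` and `W'` over `Q`, the two maps to `W'` agree in `Q`, so they differ by
  -- some `m` into `Y`. Correcting `b` by `m` makes it vanish on the kernel of `r`, and it descends
  -- to the inverse of `f`.
  obtain ⟨m, hm⟩ := h'.lift (r - b ≫ f) (by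
    rw [Preadditive.sub_comp, Category.assoc, hp, sq.w, sub_self])
  obtain ⟨g, hg⟩ := hc.desc (b + m ≫ i) (by
    have : j ≫ m = - 𝟙 Y := by
      rw [← cancel_mono i', Category.assoc, hm, Preadditive.comp_sub, hc.zero, reassoc_of% w, hi]
      simp
    rw [Preadditive.comp_add, w, reassoc_of% this]; simp)
  have hgf : g ≫ f = 𝟙 W' := by
    rw [← cancel_epi r, reassoc_of% hg, Preadditive.add_comp, Category.assoc, hi, hm]
    simp
  exact ⟨g, by rw [← cancel_mono f, Category.assoc, hgf]; simp, hgf⟩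

variable [HasBinaryBiproducts C]

/-- The inflation `𝟙 X` has zero cokernel, and pulling its conflation back along the zero map from
`Y` gives the split sequence. -/
lemma conf_inl_snd (X Y : C) :
    E.Conf (biprod.inl : X ⟶ X ⊞ Y) (biprod.snd : X ⊞ Y ⟶ Y) := by
  obtain ⟨Z, q, hw, h⟩ := E.id_inflation X
  have h : E.Conf (𝟙 X) q := ⟨hw, h⟩
  obtain ⟨P, i, p, b, hc, w, sq⟩ := pullback_conf h (0 : Y ⟶ Z)
  have hq : q = 0 := by simpa using hw
  subst hq
  refine hc.of_iso (Iso.refl _) ⟨biprod.lift b p, sq.lift biprod.fst biprod.snd (by simp), ?_, ?_⟩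
    (Iso.refl _) ?_ (by simp)
  · exact sq.hom_ext (by simp) (by simp)
  · ext <;> simp
  · ext <;> simp [w, hc.zero]

end ExactStructure

namespace ExactStructure

variable {C : Type u} [Category.{v} C] [Preadditive C] {E : ExactStructure C}

/-- If the inflation of a conflation has a retraction, the deflation has a section. -/
lemma exists_section_of_retraction {X Y Z : C} {i : X ⟶ Y} {p : Y ⟶ Z} (h : E.Conf i p)
    {r : Y ⟶ X} (hr : i ≫ r = 𝟙 X) : ∃ s : Z ⟶ Y, s ≫ p = 𝟙 Z := by
  obtain ⟨s, hs⟩ := h.desc (𝟙 Y - r ≫ i) (by simp [reassoc_of% hr])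
  have := h.epi
  exact ⟨s, by rw [← cancel_epi p, reassoc_of% hs]; simp [h.zero]⟩

/-- If the deflation of a conflation has a section, the inflation has a retraction. -/
lemma exists_retraction_of_section {X Y Z : C} {i : X ⟶ Y} {p : Y ⟶ Z} (h : E.Conf i p)
    {s : Z ⟶ Y} (hs : s ≫ p = 𝟙 Z) : ∃ r : Y ⟶ X, i ≫ r = 𝟙 X := by
  obtain ⟨r, hr⟩ := h.lift (𝟙 Y - p ≫ s) (by simp [hs])
  have := h.mono
  exact ⟨r, by rw [← cancel_mono i, Category.assoc, hr]; simp [reassoc_of% h.zero]⟩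

lemma conf_id_zero {X Z : C} (hZ : IsZero Z) : E.Conf (𝟙 X) (0 : X ⟶ Z) := by
  obtain ⟨Z', q, hw, h⟩ := E.id_inflation X
  have h : E.Conf (𝟙 X) q := ⟨hw, h⟩
  have hq : q = 0 := by simpa using hw
  have := h.epi
  have hZ' : IsZero Z' := by
    rw [IsZero.iff_id_eq_zero, ← cancel_epi q, hq]; simp
  exact h.of_iso (Iso.refl _) (Iso.refl _) (hZ'.iso hZ) (by simp) (by simp [hq])

lemma conf_zero_id {X Z : C} (hZ : IsZero Z) : E.Conf (0 : Z ⟶ X) (𝟙 X) :=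
  (conf_id_zero (E := E.opposite) (X := Opposite.op X) hZ.op).unop

variable [HasBinaryBiproducts C]

/-- Adding the identity of `V` to the deflation of a conflation. -/
lemma conf_biprod_right {A B X : C} {i : A ⟶ B} {p : B ⟶ X} (h : E.Conf i p) (V : C) :
    E.Conf (i ≫ biprod.inl) (biprod.map p (𝟙 V)) := by
  obtain ⟨P, i', p', b, hc, w, sq⟩ := pullback_conf h (biprod.fst : X ⊞ V ⟶ X)
  refine hc.of_iso (Iso.refl _) ⟨biprod.lift b (p' ≫ biprod.snd),
    sq.lift biprod.fst (biprod.map p (𝟙 V)) (by simp), ?_, ?_⟩ (Iso.refl _) ?_ ?_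
  · refine sq.hom_ext (by simp) ?_
    ext <;> simp [sq.w]
  · ext <;> simp
  · ext <;> simp [w, reassoc_of% hc.zero]
  · ext <;> simp [sq.w]

/-- Adding the identity of `V` to the inflation of a conflation. -/
lemma conf_biprod_left {A B X : C} {i : A ⟶ B} {p : B ⟶ X} (h : E.Conf i p) (V : C) :
    E.Conf (biprod.map i (𝟙 V)) (biprod.fst ≫ p) := by
  obtain ⟨P, i', p', b, hc, w, sq⟩ := pushout_conf h (biprod.inl : A ⟶ A ⊞ V)
  refine hc.of_iso (Iso.refl _) ⟨sq.desc biprod.inl (biprod.map i (𝟙 V)) (by simp),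
    biprod.desc b (biprod.inr ≫ i'), ?_, ?_⟩ (Iso.refl _) ?_ ?_
  · refine sq.hom_ext (by simp) ?_
    ext <;> simp [sq.w]
  · ext <;> simp
  · simp
  · refine sq.hom_ext (by simp [w]) ?_
    ext <;> simp [hc.zero, h.zero]

/-- The conflation expressing a pullback along a deflation as a kernel. -/
lemma conf_of_isPullback {X K Y Q W : C} {i : Y ⟶ X} {p : X ⟶ K} (h : E.Conf i p) {q : Q ⟶ K}
    {b : W ⟶ X} {p' : W ⟶ Q} (sq : IsPullback b p' p q) :
    E.Conf (biprod.lift b p') (biprod.desc p (-q)) := by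
  let c : K ⊞ Q ≅ K ⊞ Q :=
    { hom := biprod.lift (biprod.desc (𝟙 _) (-q)) biprod.snd
      inv := biprod.lift (biprod.desc (𝟙 _) q) biprod.snd
      hom_inv_id := by ext <;> simp
      inv_hom_id := by ext <;> simp }
  have h₁ := conf_inl_snd (E := E) Q K
  have h₂ : E.Conf (biprod.lift q (𝟙 Q)) (biprod.desc (𝟙 K) (-q)) := by
    refine h₁.of_iso (Iso.refl _) ⟨biprod.lift (biprod.desc q (𝟙 K)) biprod.fst,
      biprod.lift biprod.snd (biprod.desc (𝟙 K) (-q)), ?_, ?_⟩ (Iso.refl _) ?_ ?_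
    · ext <;> simp
    · ext <;> simp
    · ext <;> simp
    · ext <;> simp
  -- The map `(p, -q)` is a deflation, being `p ⊞ 𝟙` followed by the split deflation `(𝟙, -q)`; its
  -- kernel is the pullback.
  obtain ⟨P, a, h₃⟩ := E.comp_deflation _ _ ⟨_, _, conf_biprod_right h Q⟩ ⟨_, _, h₂⟩
  have h₃ : E.Conf a _ := h₃
  have he : biprod.map p (𝟙 Q) ≫ biprod.desc (𝟙 K) (-q) = biprod.desc p (-q) := by
    ext <;> simp
  rw [he] at h₃
  have : Mono (biprod.lift b p') := ⟨fun x y hxy => sq.hom_ext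
    (by simpa using congrArg (· ≫ biprod.fst) hxy) (by simpa using congrArg (· ≫ biprod.snd) hxy)⟩
  refine h₃.of_isKernel _ (by simp [sq.w]) ⟨sq.lift (a ≫ biprod.fst) (a ≫ biprod.snd) ?_, ?_⟩
  · have := h₃.zero
    rw [biprod.desc_eq, Preadditive.comp_add] at this
    simpa [add_neg_eq_zero] using this
  · ext <;> simp

lemma nonempty_iso_biprod {X Y Z : C} {i : X ⟶ Y} {p : Y ⟶ Z} (h : E.Conf i p) {s : Z ⟶ Y}
    (hs : s ≫ p = 𝟙 Z) : Nonempty (Y ≅ X ⊞ Z) := by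
  have := isIso_of_conf (conf_inl_snd X Z) h (biprod.desc i s) (by simp)
    (by ext <;> simp [hs, h.zero])
  exact ⟨(asIso (biprod.desc i s)).symm⟩

end ExactStructure

/-! ### Recursive resolutions and coresolutions -/

namespace ConflationStructure

variable {C : Type u} [Category.{v} C] [Preadditive C] (E : ConflationStructure C)

/-- Objects with a coresolution by `n` objects of `U`, built recursively from conflations. -/
def Cores (U : ObjectProperty C) : ℕ → ObjectProperty C
  | 0 => fun X => IsZero X
  | n + 1 => fun X => ∃ (V X' : C) (i : X ⟶ V) (p : V ⟶ X'), E.Conf i p ∧ U V ∧ Cores U n X'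

/-- Objects with a resolution by `n` objects of `U`, built recursively from conflations. -/
def Res (U : ObjectProperty C) : ℕ → ObjectProperty C
  | 0 => fun X => IsZero X
  | n + 1 => fun X => ∃ (X' V : C) (i : X' ⟶ V) (p : V ⟶ X), E.Conf i p ∧ U V ∧ Res U n X'

/-- Variant of `Cores` in which all the terms and cosyzygies are required to lie in `P`. -/
def CoresIn (P U : ObjectProperty C) : ℕ → ObjectProperty C
  | 0 => fun X => P X ∧ IsZero X
  | n + 1 => fun X => P X ∧
      ∃ (V X' : C) (i : X ⟶ V) (p : V ⟶ X'), E.Conf i p ∧ U V ∧ P V ∧ CoresIn P U n X'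

/-- Variant of `Res` in which all the terms and syzygies are required to lie in `P`. -/
def ResIn (P U : ObjectProperty C) : ℕ → ObjectProperty C
  | 0 => fun X => P X ∧ IsZero X
  | n + 1 => fun X => P X ∧
      ∃ (X' V : C) (i : X' ⟶ V) (p : V ⟶ X), E.Conf i p ∧ U V ∧ P V ∧ ResIn P U n X'

variable {E} {P U : ObjectProperty C}

lemma cores_iff_opposite (n : ℕ) (X : C) :
    E.Cores U n X ↔ E.opposite.Res U.op n (Opposite.op X) := by
  induction n generalizing X with
  | zero => exact ⟨fun h => IsZero.op h, fun h => IsZero.unop h⟩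
  | succ n ih =>
    constructor
    · rintro ⟨V, X', i, p, h, hV, hX⟩
      exact ⟨_, _, p.op, i.op, h.op, hV, (ih _).1 hX⟩
    · rintro ⟨X', V, i, p, h, hV, hX⟩
      exact ⟨_, _, p.unop, i.unop, h.unop, hV, (ih _).2 hX⟩

lemma res_iff_opposite (n : ℕ) (X : C) :
    E.Res U n X ↔ E.opposite.Cores U.op n (Opposite.op X) := by
  induction n generalizing X with
  | zero => exact ⟨fun h => IsZero.op h, fun h => IsZero.unop h⟩
  | succ n ih =>
    constructor
    · rintro ⟨X', V, i, p, h, hV, hX⟩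
      exact ⟨_, _, p.op, i.op, h.op, hV, (ih _).1 hX⟩
    · rintro ⟨V, X', i, p, h, hV, hX⟩
      exact ⟨_, _, p.unop, i.unop, h.unop, hV, (ih _).2 hX⟩

lemma coresIn_iff_opposite (n : ℕ) (X : C) :
    E.CoresIn P U n X ↔ E.opposite.ResIn P.op U.op n (Opposite.op X) := by
  induction n generalizing X with
  | zero => exact ⟨fun h => ⟨h.1, IsZero.op h.2⟩, fun h => ⟨h.1, IsZero.unop h.2⟩⟩
  | succ n ih =>
    constructor
    · rintro ⟨hP, V, X', i, p, h, hV, hV', hX⟩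
      exact ⟨hP, _, _, p.op, i.op, h.op, hV, hV', (ih _).1 hX⟩
    · rintro ⟨hP, X', V, i, p, h, hV, hV', hX⟩
      exact ⟨hP, _, _, p.unop, i.unop, h.unop, hV, hV', (ih _).2 hX⟩

lemma resIn_iff_opposite (n : ℕ) (X : C) :
    E.ResIn P U n X ↔ E.opposite.CoresIn P.op U.op n (Opposite.op X) := by
  induction n generalizing X with
  | zero => exact ⟨fun h => ⟨h.1, IsZero.op h.2⟩, fun h => ⟨h.1, IsZero.unop h.2⟩⟩
  | succ n ih =>
    constructor
    · rintro ⟨hP, X', V, i, p, h, hV, hV', hX⟩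
      exact ⟨hP, _, _, p.op, i.op, h.op, hV, hV', (ih _).1 hX⟩
    · rintro ⟨hP, V, X', i, p, h, hV, hV', hX⟩
      exact ⟨hP, _, _, p.unop, i.unop, h.unop, hV, hV', (ih _).2 hX⟩

lemma Res.of_iso {n : ℕ} {X Y : C} (h : E.Res U n X) (e : X ≅ Y) : E.Res U n Y := by
  cases n with
  | zero => exact IsZero.of_iso h e.symm
  | succ n =>
    obtain ⟨X', V, i, p, h, hV, hX⟩ := h
    exact ⟨X', V, i, _, h.of_iso_right e, hV, hX⟩

lemma Cores.of_iso {n : ℕ} {X Y : C} (h : E.Cores U n X) (e : X ≅ Y) : E.Cores U n Y := by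
  cases n with
  | zero => exact IsZero.of_iso h e.symm
  | succ n =>
    obtain ⟨X', V, i, p, h, hV, hX⟩ := h
    exact ⟨X', V, _, p, h.of_iso_left e.symm, hV, hX⟩

lemma CoresIn.of_iso {n : ℕ} {X Y : C} (hP : ∀ {X Y : C}, P X → (X ≅ Y) → P Y)
    (h : E.CoresIn P U n X) (e : X ≅ Y) : E.CoresIn P U n Y := by
  cases n with
  | zero => exact ⟨hP h.1 e, IsZero.of_iso h.2 e.symm⟩
  | succ n =>
    obtain ⟨h', X', V, i, p, h, hV, hX⟩ := h
    exact ⟨hP h' e, X', V, _, p, h.of_iso_left e.symm, hV, hX⟩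

lemma CoresIn.prop {n : ℕ} {X : C} (h : E.CoresIn P U n X) : P X := by
  cases n with
  | zero => exact h.1
  | succ n => exact h.1

lemma ResIn.prop {n : ℕ} {X : C} (h : E.ResIn P U n X) : P X := by
  cases n with
  | zero => exact h.1
  | succ n => exact h.1

lemma CoresIn.cores {n : ℕ} {X : C} (h : E.CoresIn P U n X) : E.Cores U n X := by
  induction n generalizing X with
  | zero => exact h.2
  | succ n ih =>
    obtain ⟨-, V, X', i, p, h, hV, -, hX⟩ := h
    exact ⟨V, X', i, p, h, hV, ih hX⟩

end ConflationStructure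

/-! ### Exchanging resolutions and coresolutions, given splitting -/

namespace ExactStructure

open ConflationStructure

variable {C : Type u} [Category.{v} C] [Preadditive C] {E : ExactStructure C}
  {P U : ObjectProperty C} {d : ℕ}

variable (E U d) in
/-- Every conflation with left term in `U` and right term coresolved by `j < d` objects of `U`
splits, and dually. -/
structure SplitsBelow : Prop where
  cores : ∀ {j : ℕ}, j < d → ∀ {V M Z : C} {i : V ⟶ M} {p : M ⟶ Z}, E.Conf i p → U V →
    E.Cores U j Z → ∃ s : Z ⟶ M, s ≫ p = 𝟙 Z
  res : ∀ {j : ℕ}, j < d → ∀ {Z M V : C} {i : Z ⟶ M} {p : M ⟶ V}, E.Conf i p → U V →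
    E.Res U j Z → ∃ s : V ⟶ M, s ≫ p = 𝟙 V

lemma SplitsBelow.opposite (h : E.SplitsBelow U d) : E.opposite.SplitsBelow U.op d where
  cores hj _ _ _ _ _ hc hV hZ := by
    obtain ⟨s, hs⟩ := h.res hj hc.unop hV ((res_iff_opposite _ _).2 hZ)
    obtain ⟨r, hr⟩ := exists_retraction_of_section hc.unop hs
    exact ⟨r.op, Quiver.Hom.unop_inj (by simpa using hr)⟩
  res hj _ _ _ _ _ hc hV hZ := by
    obtain ⟨s, hs⟩ := h.cores hj hc.unop hV ((cores_iff_opposite _ _).2 hZ)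
    obtain ⟨r, hr⟩ := exists_retraction_of_section hc.unop hs
    exact ⟨r.op, Quiver.Hom.unop_inj (by simpa using hr)⟩

variable [HasBinaryBiproducts C]

lemma _root_.IsClosedUnderDirectSums.opposite (hU : IsClosedUnderDirectSums U) :
    IsClosedUnderDirectSums U.op := by
  obtain ⟨⟨Z, hZ, hUZ⟩, h⟩ := hU
  refine ⟨⟨Opposite.op Z, hZ.op, hUZ⟩, fun X Y hX hY => ?_⟩
  obtain ⟨W, hW, ⟨e⟩⟩ := h _ _ hX hY
  refine ⟨Opposite.op W, hW, ⟨e.symm.op ≪≫ ?_⟩⟩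
  exact
    { hom := biprod.lift biprod.inl.op biprod.inr.op
      inv := biprod.desc biprod.fst.op biprod.snd.op
      hom_inv_id := by
        rw [biprod.lift_desc, ← op_comp, ← op_comp, ← op_add, biprod.total, op_id]
      inv_hom_id := by
        ext <;> simp [← op_comp] }

section

variable (hU : IsClosedUnderDirectSums U)
include hU

lemma res_of_isZero (n : ℕ) {X : C} (hX : IsZero X) : E.Res U n X := by
  induction n generalizing X with
  | zero => exact hX
  | succ n ih =>
    obtain ⟨Z, hZ, hUZ⟩ := hU.1
    exact ⟨X, Z, 𝟙 X ≫ (hX.iso hZ).hom, 0,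
      (conf_id_zero hX).of_iso (Iso.refl _) (hX.iso hZ) (Iso.refl _) (by simp) (by simp),
      hUZ, ih hX⟩

lemma res_of_prop {n : ℕ} {V : C} (hV : U V) : E.Res U (n + 1) V := by
  obtain ⟨Z, hZ, hUZ⟩ := hU.1
  exact ⟨Z, V, 0, 𝟙 V, conf_zero_id hZ, hV, res_of_isZero hU n hZ⟩

lemma res_biprod {n : ℕ} {X V : C} (hX : E.Res U (n + 1) X) (hV : U V) :
    E.Res U (n + 1) (X ⊞ V) := by
  obtain ⟨X', V', i, p, h, hV', hX⟩ := hX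
  obtain ⟨W, hW, ⟨e⟩⟩ := hU.2 _ _ hV' hV
  exact ⟨X', W, _, _, (conf_biprod_right h V).of_iso (Iso.refl _) e.symm (Iso.refl _)
    (i' := i ≫ biprod.inl ≫ e.inv) (p' := e.hom ≫ biprod.map p (𝟙 V)) (by simp) (by simp),
    hW, hX⟩

lemma coresIn_biprod {n : ℕ} {X V : C} (hP : ∀ {X Y : C}, P X → (X ≅ Y) → P Y)
    (hPV : ∀ {X : C}, P X → P (X ⊞ V))
    (hX : E.CoresIn P U (n + 1) X) (hV : U V) : E.CoresIn P U (n + 1) (X ⊞ V) := by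
  obtain ⟨h', V', X', i, p, h, hV', hV₂, hX⟩ := hX
  obtain ⟨W, hW, ⟨e⟩⟩ := hU.2 _ _ hV' hV
  exact ⟨hPV h', W, X', _, _, (conf_biprod_left h V).of_iso (Iso.refl _) e.symm (Iso.refl _)
    (i' := biprod.map i (𝟙 V) ≫ e.inv) (p' := e.hom ≫ biprod.fst ≫ p) (by simp) (by simp),
    hW, hP (hPV hV₂) e.symm, hX⟩

variable (hs : E.SplitsBelow U d)
include hs

/-- The cokernel of an inflation from an object with a short resolution. -/
lemma res_of_conf {m e : ℕ} (hme : m < e) (hed : e ≤ d) {K Q X : C} {i : K ⟶ Q} {p : Q ⟶ X}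
    (h : E.Conf i p) (hK : E.Res U m K) (hQ : E.Res U e Q) : E.Res U e X := by
  induction m generalizing e K Q X with
  | zero =>
    have := h.isIso_right hK
    exact hQ.of_iso (asIso p)
  | succ m ih =>
    obtain ⟨e, rfl⟩ : ∃ k, e = k + 2 := ⟨e - 2, by omega⟩
    obtain ⟨K', K₁, k, k₁, hk, hK₁, hK'⟩ := hK
    obtain ⟨Q', Q₁, j, q, hq, hQ₁, hQ'⟩ := hQ
    -- The kernel `P` of `Q₁ ⟶ X` is an extension of `K` by `Q'`. Pulled back to `K₁` this extension
    -- splits, so `P` is the cokernel of an inflation `K' ⟶ Q' ⊞ K₁`, and both lengths have dropped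
    -- by one.
    obtain ⟨P, a, j', q', ha, hj', -, -⟩ := conf_comp h hq
    refine ⟨P, Q₁, a, _, ha, hQ₁, ?_⟩
    obtain ⟨P₁, i₁, p₁, b₁, h₁, w₁, sq⟩ := pullback_conf hk q'
    obtain ⟨P₂, i₂, p₂, b₂, h₂, w₂, sq₂⟩ := pullback_conf hj' k₁
    obtain ⟨s, hs'⟩ := hs.res (by omega) h₂ hK₁ hQ'
    obtain ⟨f⟩ := nonempty_iso_biprod h₂ hs'
    have e₁ : P₁ ≅ P₂ := sq.isoIsPullback _ _ sq₂.flip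
    exact ih (by omega) (by omega) h₁ hK' ((res_biprod hU hQ' hK₁).of_iso (f.symm ≪≫ e₁.symm))

/-- The invariant `m + e = d` survives each step along the coresolution of `X`: the kernel gains a
resolving term while `Q` loses a coresolving one. At `e = 0` nothing is needed of `Q`, since `X` is
then isomorphic to an object of `U`; `CoresIn` of length zero would wrongly force `Q` to vanish. -/
lemma coresIn_of_conf {m e : ℕ} (hme : m + e = d) (hd : 0 < d) {K Q X : C} {i : K ⟶ Q}
    {p : Q ⟶ X} (h : E.Conf i p) (hK : E.Res U m K)
    (hQ : e = 0 ∨ E.CoresIn (E.Res U d) U e Q) (hX : E.Cores U (e + 1) X) :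
    E.CoresIn (E.Res U d) U (e + 1) X := by
  obtain ⟨d, rfl⟩ : ∃ k, d = k + 1 := ⟨d - 1, by omega⟩
  induction e generalizing m K Q X with
  | zero =>
    obtain ⟨V, X', j, q, hj, hV, hX'⟩ := hX
    have := hj.isIso_left hX'
    exact ⟨(res_of_prop hU hV).of_iso (asIso j).symm, V, X', j, q, hj, hV, res_of_prop hU hV,
      res_of_isZero hU _ hX', hX'⟩
  | succ e ih =>
    have hQ := hQ.resolve_left (by omega)
    have hX' := res_of_conf hU hs (by omega) le_rfl h hK hQ.prop
    obtain ⟨V, Y, j, q, hj, hV, hY⟩ := hX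
    refine ⟨hX', V, Y, j, q, hj, hV, res_of_prop hU hV, ?_⟩
    obtain ⟨-, N, A, k, r, hk, hN, -, hA⟩ := hQ
    -- Here `K' = N / K` is an extension of `A` by `X`. The pushout `Q'` of `V` and `K'` under `X`
    -- is an extension of `A` by `V`, which splits, and an extension of `Y` by `K'`, which feeds the
    -- induction.
    obtain ⟨K', a, j', q', ha, hj', -, -⟩ := comp_conf h hk
    obtain ⟨Q', b, c, f, g, hb, hf⟩ := pushout_two_conf hj hj'
    have hK' : E.Res U (m + 1) K' := ⟨K, N, _, _, ha, hN, hK⟩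
    refine ih (by omega) (h := hf) (hK := hK') (hQ := ?_) (hX := hY)
    cases e with
    | zero => exact Or.inl rfl
    | succ e =>
      refine Or.inr ?_
      obtain ⟨s, hs'⟩ := hs.cores (by omega) hb hV hA.cores
      obtain ⟨φ⟩ := nonempty_iso_biprod hb hs'
      exact (coresIn_biprod hU (fun h e => h.of_iso e) (fun h => res_biprod hU h hV) hA hV).of_iso
        (fun h e => h.of_iso e) ((biprod.braiding _ _) ≪≫ φ.symm)

omit hs in
lemma coresIn_of_isZero (n : ℕ) {X : C} (hX : IsZero X) : E.CoresIn (E.Res U d) U n X := by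
  induction n generalizing X with
  | zero => exact ⟨res_of_isZero hU _ hX, hX⟩
  | succ n ih =>
    obtain ⟨Z, hZ, hUZ⟩ := hU.1
    exact ⟨res_of_isZero hU _ hX, Z, X, 0, 0 ≫ 𝟙 X,
      (conf_id_zero hX).of_iso (Iso.refl _) (hX.iso hZ) (Iso.refl _) (hX.eq_of_src _ _)
        (hX.eq_of_tgt _ _), hUZ, res_of_isZero hU _ hZ, ih hX⟩

/-- The key step: the cokernel of an inflation into an object of `U`. -/
lemma coresIn_of_conf_of_prop (hd : 0 < d) {A B X : C} {i : A ⟶ B} {p : B ⟶ X} (h : E.Conf i p)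
    (hA : E.CoresIn (E.Res U d) U d A) (hB : U B) (hX : E.Cores U d X) :
    E.CoresIn (E.Res U d) U d X := by
  obtain ⟨e, rfl⟩ : ∃ k, d = k + 1 := ⟨d - 1, by omega⟩
  obtain ⟨-, V, A', j, q, hj, hV, -, hA'⟩ := hA
  obtain ⟨Q, b, b', c, c', hb, hc⟩ := pushout_two_conf h hj
  refine coresIn_of_conf hU hs (m := 1) (by omega) hd hc (res_of_prop hU hV) ?_ hX
  cases e with
  | zero => exact Or.inl rfl
  | succ e =>
    obtain ⟨s, hs'⟩ := hs.cores (by omega) hb hB hA'.cores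
    obtain ⟨φ⟩ := nonempty_iso_biprod hb hs'
    exact Or.inr ((coresIn_biprod hU (fun h e => h.of_iso e) (fun h => res_biprod hU h hB) hA'
      hB).of_iso (fun h e => h.of_iso e) ((biprod.braiding _ _) ≪≫ φ.symm))

/-- The resolution length `n` is kept free so that one can induct on it, while every syzygy has
coresolutions of the fixed length `d`. -/
lemma coresIn_of_resIn (hd : 0 < d) {n : ℕ} {X : C} (hX : E.ResIn (E.Cores U d) U n X) :
    E.CoresIn (E.Res U d) U d X := by
  induction n generalizing X with
  | zero => exact coresIn_of_isZero hU d hX.2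
  | succ n ih =>
    obtain ⟨hX', A, B, i, p, h, hB, -, hA⟩ := hX
    exact coresIn_of_conf_of_prop hU hs hd h (ih hA) hB hX'

lemma resIn_of_coresIn (hd : 0 < d) {n : ℕ} {X : C} (hX : E.CoresIn (E.Res U d) U n X) :
    E.ResIn (E.Cores U d) U d X := by
  rw [resIn_iff_opposite]
  have h₁ : (E.Cores U d).op = E.opposite.Res U.op d := by
    ext X; exact cores_iff_opposite d _
  have h₂ : (E.Res U d).op = E.opposite.Cores U.op d := by
    ext X; exact res_iff_opposite d _
  rw [coresIn_iff_opposite, h₂] at hX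
  rw [h₁]
  exact coresIn_of_resIn hU.opposite hs.opposite hd hX

end

end ExactStructure

/-! ### Yoneda extensions as chains of conflations -/

namespace ConflationStructure

variable {C : Type u} [Category.{v} C] [Preadditive C]

/-- Exact sequences `0 ⟶ Y ⟶ E₁ ⟶ ⋯ ⟶ Eₙ ⟶ V ⟶ 0`, given by the conflations from which they
are spliced. -/
inductive Chain (E : ConflationStructure C) (V : C) : ℕ → C → Type (max u v)
  | nil : Chain E V 0 V
  | cons {n : ℕ} {Y X K : C} (i : Y ⟶ X) (p : X ⟶ K) (h : E.Conf i p) (S : Chain E V n K) :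
      Chain E V (n + 1) Y

namespace Chain

variable {E : ConflationStructure C} {V : C}

/-- Appending a conflation to an exact sequence. -/
def snoc {W Z : C} {i : V ⟶ W} {p : W ⟶ Z} (h : E.Conf i p) :
    ∀ {n : ℕ} {Y : C}, E.Chain V n Y → E.Chain Z (n + 1) Y
  | _, _, nil => cons i p h nil
  | _, _, cons j q h' S => cons j q h' (S.snoc h)

/-- `S.LiftsAlong q` for `q : Q ⟶ Y`: there is an exact sequence `0 ⟶ Q ⟶ ⋯ ⟶ V ⟶ 0` with a
morphism to `S` which is `q` on the left end and a split epimorphism on the right end. -/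
def LiftsAlong : ∀ {n : ℕ} {Y : C}, E.Chain V n Y → ∀ {Q : C}, (Q ⟶ Y) → Prop
  | _, _, nil, _, q => ∃ s, s ≫ q = 𝟙 V
  | _, _, cons (X := X) (K := K) j r _ S, Q, q =>
      ∃ (R Q' : C) (j' : Q ⟶ R) (r' : R ⟶ Q') (x : R ⟶ X) (k : Q' ⟶ K),
        E.Conf j' r' ∧ j' ≫ x = q ≫ j ∧ r' ≫ k = x ≫ r ∧ S.LiftsAlong k

/-- `S.KilledBy u` for `u : Y ⟶ Y'`: there is an exact sequence `0 ⟶ Y' ⟶ ⋯ ⟶ V' ⟶ 0` and a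
morphism from `S` which is `u` on the left end and zero on the right end. -/
def KilledBy : ∀ {n : ℕ} {Y : C}, E.Chain V n Y → ∀ {Y' : C}, (Y ⟶ Y') → Prop
  | _, _, nil, _, u => u = 0
  | _, _, cons (X := X) (K := K) j r _ S, Y', u =>
      ∃ (X' K' : C) (j' : Y' ⟶ X') (r' : X' ⟶ K') (x : X ⟶ X') (k : K ⟶ K'),
        E.Conf j' r' ∧ j ≫ x = u ≫ j' ∧ r ≫ k = x ≫ r' ∧ S.KilledBy k

end Chain

/-- Every exact sequence `0 ⟶ Y ⟶ E₀ ⟶ ⋯ ⟶ Eₙ ⟶ V ⟶ 0` receives a morphism, the identity on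
the ends, from an exact sequence whose first map is a split monomorphism. -/
def LeftVanishes (E : ConflationStructure C) (n : ℕ) (V Y : C) : Prop :=
  ∀ ⦃X K : C⦄ (i : Y ⟶ X) (p : X ⟶ K), E.Conf i p → ∀ S : E.Chain V n K,
    ∃ (Q : C) (l : Q ⟶ X), S.LiftsAlong (l ≫ p)

/-- Every exact sequence `0 ⟶ Y ⟶ E₀ ⟶ ⋯ ⟶ Eₙ ⟶ V ⟶ 0` has a morphism, the identity on
the ends, to an exact sequence whose last map is a split epimorphism. -/
def RightVanishes (E : ConflationStructure C) (n : ℕ) (V Y : C) : Prop :=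
  ∀ S : E.Chain V (n + 1) Y, S.KilledBy (𝟙 Y)

end ConflationStructure

/-! ### One-sided triviality of extensions and dimension shifting -/

namespace ExactStructure

open ConflationStructure Chain

variable {C : Type u} [Category.{v} C] [Preadditive C] {E : ExactStructure C} {V : C}

lemma liftsAlong_id {n : ℕ} {Y : C} (S : E.Chain V n Y) : S.LiftsAlong (𝟙 Y) := by
  induction S with
  | nil => exact ⟨𝟙 _, by simp⟩
  | cons j r h S ih => exact ⟨_, _, j, r, 𝟙 _, 𝟙 _, h, by simp, by simp, ih⟩

lemma killedBy_of_isZero (hV : IsZero V) {n : ℕ} {Y : C} (S : E.Chain V n Y) {Y' : C}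
    (u : Y ⟶ Y') : S.KilledBy u := by
  induction S generalizing Y' with
  | nil => exact hV.eq_of_src u 0
  | cons j r h S ih =>
    obtain ⟨X', j', r', b, h', w, sq⟩ := pushout_conf h u
    exact ⟨_, _, j', r', b, 𝟙 _, h', sq.w, by simp [w], ih _⟩

/-- A lift of `S` along `q` is itself an exact sequence, up to precomposition of `q`. -/
lemma exists_chain_of_liftsAlong {n : ℕ} {Y : C} (S : E.Chain V n Y) {Q : C} {q : Q ⟶ Y}
    (hq : S.LiftsAlong q) : ∃ (Q₀ : C) (g : Q₀ ⟶ Q) (T : E.Chain V n Q₀),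
      ∀ ⦃Q₁ : C⦄ (t : Q₁ ⟶ Q₀), T.LiftsAlong t → S.LiftsAlong (t ≫ g ≫ q) := by
  induction S generalizing Q with
  | nil =>
    -- The right end of a lift is only a split epimorphism onto `V`; pulling back along its section
    -- makes the end equal to `V`. Only in length zero does this change the left end, whence the map
    -- `g`.
    obtain ⟨s, hs⟩ := hq
    refine ⟨_, s, nil, ?_⟩
    rintro Q₁ t ⟨s', hs'⟩
    exact ⟨s', by rw [hs, Category.comp_id, hs']⟩
  | cons j r h S ih =>
    obtain ⟨R, Q', j', r', x, k, h', hx, hk, hS⟩ := hq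
    obtain ⟨Q₀, g, T, hT⟩ := ih hS
    obtain ⟨R₀, j₀, r₀, b, h₀, w, sq⟩ := pullback_conf h' g
    refine ⟨Q, 𝟙 _, cons j₀ r₀ h₀ T, ?_⟩
    rintro Q₁ t ⟨R₁, Q₁', j₁, r₁, x₁, k₁, h₁, hx₁, hk₁, hS₁⟩
    refine ⟨R₁, Q₁', j₁, r₁, x₁ ≫ b ≫ x, _, h₁, ?_, ?_, hT _ hS₁⟩
    · rw [reassoc_of% hx₁, reassoc_of% w, hx]; simp
    · rw [reassoc_of% hk₁, ← reassoc_of% sq.w, hk]; simp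

/-- Factorisation of a killed extended sequence. -/
lemma exists_chain_of_killedBy_snoc {W Z : C} {a : V ⟶ W} {c : W ⟶ Z} (hc : E.Conf a c) {n : ℕ}
    {Y : C} (S : E.Chain V n Y) {Y' : C} {u : Y ⟶ Y'} (hu : (S.snoc hc).KilledBy u) :
    (∃ (Y₀ : C) (u₀ : Y ⟶ Y₀) (g : Y₀ ⟶ Y') (T : E.Chain W n Y₀), u₀ ≫ g = u ∧
      ∀ ⦃Y₁ : C⦄ (t : Y₀ ⟶ Y₁), T.KilledBy t → S.KilledBy (u₀ ≫ t)) ∧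
    -- In positive length the left end can be kept equal to `Y'`. The induction starts from length
    -- zero, where only the weaker first clause holds.
    (n ≠ 0 → ∃ T : E.Chain W n Y',
      ∀ ⦃Y₁ : C⦄ (t : Y' ⟶ Y₁), T.KilledBy t → S.KilledBy (u ≫ t)) := by
  induction S generalizing Y' with
  | nil =>
    obtain ⟨X', K', j', r', x, k, h', hx, hk, hS⟩ := hu
    obtain rfl : k = 0 := hS
    obtain ⟨g, hg⟩ := h'.lift x (by rw [← hk, comp_zero])
    have := h'.mono
    refine ⟨⟨W, a, g, nil, ?_, ?_⟩, fun h => (h rfl).elim⟩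
    · rw [← cancel_mono j', Category.assoc, hg, hx]
    · rintro Y₁ t (rfl : t = 0)
      exact comp_zero
  | @cons n Y X K j r h S ih =>
    obtain ⟨X', K', j', r', x, k, h', hx, hk, hS⟩ := hu
    obtain ⟨⟨K₀, k₀, g, T, hg, hT⟩, -⟩ := ih hS
    obtain ⟨X₀, j₀, r₀, b, h₀, w, sq⟩ := pullback_conf h' g
    have hw : x ≫ r' = (r ≫ k₀) ≫ g := by rw [Category.assoc, hg, hk]
    have key : ∃ T : E.Chain W (n + 1) Y',
        ∀ ⦃Y₁ : C⦄ (t : Y' ⟶ Y₁), T.KilledBy t → (cons j r h S).KilledBy (u ≫ t) := by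
      refine ⟨cons j₀ r₀ h₀ T, ?_⟩
      rintro Y₁ t ⟨X₁, K₁, j₁, r₁, x₁, k₁, h₁, hx₁, hk₁, hS₁⟩
      refine ⟨X₁, K₁, j₁, r₁, sq.lift x (r ≫ k₀) hw ≫ x₁, k₀ ≫ k₁, h₁, ?_, ?_, hT _ hS₁⟩
      · have : j ≫ sq.lift x (r ≫ k₀) hw = u ≫ j₀ := by
          refine sq.hom_ext ?_ ?_
          · simp [w, hx]
          · simp [h₀.zero, reassoc_of% h.zero]
        rw [reassoc_of% this, hx₁, Category.assoc]
      · simp [← hk₁]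
    obtain ⟨T', hT'⟩ := key
    exact ⟨⟨Y', u, 𝟙 _, T', Category.comp_id _, hT'⟩, fun _ => ⟨T', hT'⟩⟩

lemma killedBy_precomp {n : ℕ} {Y K X : C} {i : Y ⟶ X} {p : X ⟶ K} (h : E.Conf i p)
    (S : E.Chain V n K) {Y₀ X₀ : C} {i₀ : Y₀ ⟶ X₀} {p₀ : X₀ ⟶ K} (h₀ : E.Conf i₀ p₀) (y : Y ⟶ Y₀)
    (x : X ⟶ X₀) (hy : i ≫ x = y ≫ i₀) (hx : x ≫ p₀ = p) {Y₁ : C} {t : Y₀ ⟶ Y₁}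
    (ht : (cons i₀ p₀ h₀ S).KilledBy t) : (cons i p h S).KilledBy (y ≫ t) := by
  obtain ⟨X₁, K₁, j₁, r₁, x₁, k₁, h₁, hx₁, hk₁, hS₁⟩ := ht
  exact ⟨X₁, K₁, j₁, r₁, x ≫ x₁, k₁, h₁, by rw [reassoc_of% hy, hx₁, Category.assoc],
    by rw [← hx, Category.assoc, hk₁, Category.assoc], hS₁⟩

/-- This is exactness of `Extⁿ⁺¹(V, W) ⟶ Extⁿ⁺¹(V, Z) ⟶ Extⁿ⁺²(V, Z')` in the middle. Triviality of
the sequence spliced with `Z' ⟶ W ⟶ Z` produces, by pushout along `l`, an extension starting at `W`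
that maps to the given one. -/
lemma leftVanishes_of_conf {n : ℕ} {Z' W Z : C} {a : Z' ⟶ W} {c : W ⟶ Z} (hc : E.Conf a c)
    (hW : E.LeftVanishes n V W) (hZ' : E.LeftVanishes (n + 1) V Z') : E.LeftVanishes n V Z := by
  intro X K i p h S
  obtain ⟨Q, l, R, Q', j', r', x, k, h', hx, hk, hS⟩ := hZ' a c hc (cons i p h S)
  obtain ⟨N, i₁, p₁, b, h₁, w, sq⟩ := pushout_conf h' l
  let f : N ⟶ X := sq.desc x (c ≫ i) (by rw [hx, Category.assoc])
  have hf : f ≫ p = p₁ ≫ k := by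
    refine sq.hom_ext ?_ ?_
    · simp [f, reassoc_of% w, hk]
    · simp [f, h.zero, reassoc_of% h₁.zero]
  obtain ⟨Q₀, g, T, hT⟩ := exists_chain_of_liftsAlong S hS
  obtain ⟨N₀, i₂, p₂, b₂, h₂, w₂, sq₂⟩ := pullback_conf h₁ g
  obtain ⟨Q₁, l₁, hl₁⟩ := hW _ _ h₂ T
  refine ⟨Q₁, l₁ ≫ b₂ ≫ f, ?_⟩
  have := hT _ hl₁
  rwa [Category.assoc, ← reassoc_of% sq₂.w, ← hf, ← Category.assoc b₂, ← Category.assoc l₁] at this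

/-- The contravariant counterpart: if the splice with `Z ⟶ W ⟶ Z'` is trivial, the given extension
maps to one ending at `W`, and that one is killed. -/
lemma rightVanishes_of_conf {n : ℕ} {Y Z W Z' : C} {a : Z ⟶ W} {c : W ⟶ Z'} (hc : E.Conf a c)
    (hW : E.RightVanishes n W Y) (hZ' : E.RightVanishes (n + 1) Z' Y) :
    E.RightVanishes n Z Y := by
  intro S
  obtain ⟨-, h⟩ := exists_chain_of_killedBy_snoc hc S (hZ' (S.snoc hc))
  obtain ⟨T, hT⟩ := h (by omega)
  simpa using hT _ (hW T)

variable [HasBinaryBiproducts C]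

/-- Pushing the lifted sequence out along `l` embeds `X` in `P`, and `P / Y` is the pullback `W'` of
`X₂` along `q`. The sequence that starts with `W' ⟶ X₂ ⊞ Q₂` again has a lift, so induction on the
length applies to it. -/
lemma killedBy_of_liftsAlong {n : ℕ} {K : C} (S : E.Chain V n K) {Y X Q : C} {i : Y ⟶ X}
    {p : X ⟶ K} (h : E.Conf i p) (l : Q ⟶ X) (hl : S.LiftsAlong (l ≫ p)) :
    (cons i p h S).KilledBy (𝟙 Y) := by
  induction S generalizing Y X Q with
  | nil =>
    obtain ⟨s, hs⟩ := hl
    obtain ⟨r, hr⟩ := exists_retraction_of_section h (s := s ≫ l) (by simpa using hs)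
    obtain ⟨Z, q, hw, hc⟩ := E.id_inflation Y
    exact ⟨Y, Z, 𝟙 Y, q, r, 0, ⟨hw, hc⟩, by simp [hr], by
      obtain rfl : q = 0 := by simpa using hw
      simp, rfl⟩
  | cons j₂ p₂ h₂ S ih =>
    rename_i X₂ Y₂
    obtain ⟨R, Q₂, j', r', x, q, h', hx, hk, hS⟩ := hl
    obtain ⟨P, e, f, b, hP, w, sq⟩ := pushout_conf h' l
    obtain ⟨W, a, c, g, ha, hcg, hag, sq'⟩ := comp_conf h hP
    obtain ⟨W', i', p', b', hW', w', sqW⟩ := pullback_conf h₂ q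
    have hz : e ≫ sq.desc x (p ≫ j₂) (by simpa using hx) = p ≫ j₂ := by simp
    have hy : sq'.desc _ j₂ hz ≫ p₂ = g ≫ q := by
      refine sq'.hom_ext (sq.hom_ext ?_ ?_) ?_
      · simp [reassoc_of% hag, reassoc_of% w, hk]
      · simp [reassoc_of% hag, reassoc_of% hP.zero, h₂.zero]
      · simp [reassoc_of% hcg.zero, h₂.zero]
    let φ : W ⟶ W' := sqW.lift (sq'.desc _ j₂ hz) g hy
    have hcφ : c ≫ φ = i' := sqW.hom_ext (by simp [φ, w']) (by simp [φ, hcg.zero, hW'.zero])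
    have := isIso_of_conf hcg hW' φ hcφ (by simp [φ])
    have hK := ih (conf_of_isPullback h₂ sqW) (-biprod.inr) (by simpa using hS)
    have hK' := killedBy_precomp h₂ S (conf_of_isPullback h₂ sqW) i' biprod.inl
      (by ext <;> simp [w', hW'.zero]) (by simp) hK
    rw [Category.comp_id] at hK'
    exact ⟨P, W', i ≫ e, a ≫ φ, e, i', ha.of_iso_right (asIso φ), by simp,
      by rw [← Category.assoc, sq'.w, Category.assoc, hcφ], hK'⟩

lemma rightVanishes_of_leftVanishes {n : ℕ} {Y : C} (h : E.LeftVanishes n V Y) :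
    E.RightVanishes n V Y := by
  rintro (_ | ⟨i, p, hc, S⟩)
  obtain ⟨Q, l, hl⟩ := h i p hc S
  exact killedBy_of_liftsAlong S hc l hl

/-- Dimension shifting: the vanishing of extensions between objects of `U` implies the splitting
of conflations with one end in `U` and a sufficiently short (co)resolution of the other end. -/
lemma splitsBelow_of_leftVanishes {U : ObjectProperty C} {d : ℕ}
    (hU : ∀ n, n + 1 < d → ∀ V Y, U V → U Y → E.LeftVanishes n V Y) : E.SplitsBelow U d where
  cores {j} hj V M Z i p h hV hZ := by
    -- Passing to a cosyzygy lowers `j` by one and raises the degree `n + 1` by one, so the bound is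
    -- preserved, and every degree at which rigidity is invoked stays below `d`.
    have key : ∀ (j n : ℕ) (Z : C), n + 1 + j ≤ d → E.Cores U j Z → E.RightVanishes n Z V := by
      intro j
      induction j with
      | zero => exact fun n Z _ hZ S => killedBy_of_isZero hZ S _
      | succ j ih =>
        rintro n Z hn ⟨W, Z', a, c, hc, hW, hZ'⟩
        exact rightVanishes_of_conf hc (rightVanishes_of_leftVanishes (hU n (by omega) _ _ hW hV))
          (ih (n + 1) Z' (by omega) hZ')
    obtain ⟨X', K', j', r', x, k, h', hx, hk, (rfl : k = 0)⟩ :=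
      key j 0 Z (by omega) hZ (.cons i p h .nil)
    obtain ⟨r, hr⟩ := h'.lift x (by rw [← hk, comp_zero])
    have := h'.mono
    exact exists_section_of_retraction h (r := r) (by
      rw [← cancel_mono j', Category.assoc, hr, hx])
  res {j} hj Z M V i p h hV hZ := by
    have key : ∀ (j n : ℕ) (Z : C), n + 1 + j ≤ d → E.Res U j Z → E.LeftVanishes n V Z := by
      intro j
      induction j with
      | zero =>
        intro n Z _ hZ X K i p h S
        have := h.isIso_right hZ
        exact ⟨K, inv p, by simpa using liftsAlong_id S⟩
      | succ j ih =>
        rintro n Z hn ⟨Z', W, a, c, hc, hW, hZ'⟩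
        exact leftVanishes_of_conf hc (hU n (by omega) _ _ hV hW) (ih (n + 1) Z' (by omega) hZ')
    obtain ⟨Q, l, s, hs⟩ := key j 0 Z (by omega) hZ i p h .nil
    exact ⟨s ≫ l, by simpa using hs⟩

end ExactStructure

/-! ### Exact sequences of composable arrows versus recursive resolutions -/

namespace ConflationStructure

variable {C : Type u} [Category.{v} C] [Preadditive C] (E : ConflationStructure C)

/-- `0 ⟶ A ⟶ F₀ ⟶ ⋯ ⟶ Fₙ ⟶ 0` is exact, where the first map is `a`. -/
def AcyclicFrom : ∀ {n : ℕ} (F : ComposableArrows C n) {A : C}, (A ⟶ F.obj 0) → Prop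
  | 0, F, _, a => ∃ Z, IsZero Z ∧ E.Conf a (0 : F.obj 0 ⟶ Z)
  | _ + 1, F, _, a => ∃ (A' : C) (p : F.obj 0 ⟶ A') (a' : A' ⟶ F.δ₀.obj 0),
      E.Conf a p ∧ F.map' 0 1 = p ≫ a' ∧ AcyclicFrom F.δ₀ a'

variable {E}

lemma acyclicFrom_iff {n : ℕ} (F : ComposableArrows C n) {A : C} (a : A ⟶ F.obj 0) :
    E.AcyclicFrom F a ↔ ∃ (Z : Fin (n + 2) → C) (i : ∀ k : Fin (n + 1), Z k.castSucc ⟶ F.obj k)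
      (p : ∀ k : Fin (n + 1), F.obj k ⟶ Z k.succ) (e : A ≅ Z 0), a = e.hom ≫ i 0 ∧
      IsZero (Z (Fin.last (n + 1))) ∧ (∀ k, E.Conf (i k) (p k)) ∧
      ∀ k : Fin n, F.map (homOfLE k.castSucc_le_succ) = p k.castSucc ≫ i k.succ := by
  induction n generalizing A with
  | zero =>
    constructor
    · rintro ⟨Z, hZ, h⟩
      let Z' : Fin 2 → C := Fin.cases (motive := fun _ => C) A fun _ => Z
      refine ⟨Z', Fin.cases (motive := fun k : Fin 1 => Z' k.castSucc ⟶ F.obj k) a fun k => k.elim0,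
        Fin.cases (motive := fun k : Fin 1 => F.obj k ⟶ Z' k.succ) 0 fun k => k.elim0,
        Iso.refl _, (Category.id_comp _).symm, hZ, fun k => ?_, fun k => k.elim0⟩
      induction k using Fin.cases with
      | zero => exact h
      | succ k => exact k.elim0
    · rintro ⟨Z, i, p, e, rfl, hZ, h, -⟩
      refine ⟨_, hZ, ?_⟩
      have := (h 0).of_iso_left e
      rwa [show p 0 = 0 from hZ.eq_of_tgt _ _] at this
  | succ n ih =>
    constructor
    · rintro ⟨A', q, a', h, hq, hF⟩
      obtain ⟨Z, i, p, e, rfl, hZ, hZ', hp⟩ := (ih _ _).1 hF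
      let Z' : Fin (n + 3) → C := Fin.cases (motive := fun _ => C) A Z
      refine ⟨Z', Fin.cases (motive := fun k : Fin (n + 2) => Z' k.castSucc ⟶ F.obj k) a i,
        Fin.cases (motive := fun k : Fin (n + 2) => F.obj k ⟶ Z' k.succ) (q ≫ e.hom) p,
        Iso.refl _, (Category.id_comp _).symm, hZ, ?_, ?_⟩
      · intro k
        induction k using Fin.cases with
        | zero => exact h.of_iso_right e
        | succ k => exact hZ' k
      · intro k
        induction k using Fin.cases with
        | zero => exact hq.trans (Category.assoc _ _ _).symm
        | succ k => exact hp k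
    · rintro ⟨Z, i, p, e, rfl, hZ, h, hp⟩
      refine ⟨Z 1, p 0, i 1, (h 0).of_iso_left e, hp 0, (ih F.δ₀ (i 1)).2
        ⟨fun k => Z k.succ, fun k => i k.succ, fun k => p k.succ, Iso.refl _,
          (Category.id_comp _).symm, hZ, fun k => h k.succ, fun k => hp k.succ⟩⟩

lemma isAcyclic_iff {n : ℕ} (F : ComposableArrows C n) :
    E.IsAcyclic F ↔ ∃ (A : C) (a : A ⟶ F.obj 0), IsZero A ∧ E.AcyclicFrom F a := by
  constructor
  · rintro ⟨Z, i, p, h₀, h₁, h, hp⟩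
    exact ⟨Z 0, i 0, h₀, (acyclicFrom_iff F _).2 ⟨Z, i, p, Iso.refl _,
      (Category.id_comp _).symm, h₁, h, hp⟩⟩
  · rintro ⟨A, a, hA, h⟩
    obtain ⟨Z, i, p, e, -, h₁, h, hp⟩ := (acyclicFrom_iff F a).1 h
    exact ⟨Z, i, p, hA.of_iso e.symm, h₁, h, hp⟩

lemma acyclicFrom_precomp {n : ℕ} {F : ComposableArrows C n} {A X B : C} {a : A ⟶ F.obj 0}
    (hF : E.AcyclicFrom F a) {b : B ⟶ X} {p : X ⟶ A} (h : E.Conf b p) :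
    E.AcyclicFrom (F.precomp (p ≫ a)) b :=
  ⟨A, p, a, h, rfl, hF⟩

end ConflationStructure

namespace ConflationStructure

variable {C : Type u} [Category.{v} C] [Preadditive C] {E : ConflationStructure C}

lemma AcyclicFrom.mono {n : ℕ} {F : ComposableArrows C n} {A : C} {a : A ⟶ F.obj 0}
    (h : E.AcyclicFrom F a) : Mono a := by
  cases n with
  | zero => obtain ⟨Z, -, h⟩ := h; exact h.mono
  | succ n => obtain ⟨A', p, a', h, -, -⟩ := h; exact h.mono

variable (E) in
/-- The trivial sequences `0 ⟶ X ⟶ X` and `X ⟶ X ⟶ 0` are conflations. -/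
def HasTrivialConflations : Prop :=
  ∃ Z : C, IsZero Z ∧ ∀ X : C, E.Conf (0 : Z ⟶ X) (𝟙 X) ∧ E.Conf (𝟙 X) (0 : X ⟶ Z)

variable {U : ObjectProperty C}

lemma AcyclicFrom.cores {n : ℕ} {F : ComposableArrows C n} {A : C} {a : A ⟶ F.obj 0}
    (h : E.AcyclicFrom F a) (hU : ∀ k, U (F.obj k)) : E.Cores U (n + 1) A := by
  induction n generalizing A with
  | zero => obtain ⟨Z, hZ, h⟩ := h; exact ⟨_, Z, a, 0, h, hU 0, hZ⟩
  | succ n ih =>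
    obtain ⟨A', p, a', h, -, hF⟩ := h
    exact ⟨_, A', a, p, h, hU 0, ih hF fun k => hU k.succ⟩

lemma Cores.exists_acyclicFrom {n : ℕ} {A : C} (h : E.Cores U (n + 1) A) :
    ∃ (F : ComposableArrows C n) (a : A ⟶ F.obj 0), E.AcyclicFrom F a ∧ ∀ k, U (F.obj k) := by
  induction n generalizing A with
  | zero =>
    obtain ⟨V, X', i, p, h, hV, hX⟩ := h
    obtain rfl : p = 0 := IsZero.eq_of_tgt hX _ _
    exact ⟨.mk₀ V, i, ⟨X', hX, h⟩, fun k => hV⟩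
  | succ n ih =>
    obtain ⟨V, X', i, p, h, hV, hX⟩ := h
    obtain ⟨F, a, hF, hU⟩ := ih hX
    refine ⟨F.precomp (p ≫ a), i, acyclicFrom_precomp hF h, fun k => ?_⟩
    induction k using Fin.cases with
    | zero => exact hV
    | succ k => exact hU k

/-- Asking only for trivial conflations, rather than an exact structure, allows this to be applied
to `E.restrict P` as well. -/
lemma coresolved_iff (hE : E.HasTrivialConflations) (n : ℕ) (X : C) :
    E.coresolved U n X ↔ E.Cores U n X := by
  obtain ⟨Z, hZ, hE⟩ := hE
  constructor
  · rintro ⟨F, hF, rfl, hU⟩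
    obtain ⟨A, a, hA, hF⟩ := (isAcyclic_iff F).1 hF
    cases n with
    | zero =>
      obtain ⟨Z', hZ', h⟩ := hF
      have := h.isIso_left hZ'
      exact hA.of_iso (asIso a).symm
    | succ n =>
      obtain ⟨A', p, a', h, -, hF⟩ := hF
      have := h.isIso_right hA
      exact (hF.cores fun k => hU k).of_iso (asIso p).symm
  · intro h
    cases n with
    | zero =>
      refine ⟨.mk₀ X, (isAcyclic_iff _).2 ⟨Z, 0, hZ, X, h, ?_⟩, rfl, fun k => k.elim0⟩
      have := (hE X).1
      rwa [show 𝟙 X = 0 from IsZero.eq_of_src h _ _] at this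
    | succ n =>
      obtain ⟨F, a, hF, hU⟩ := h.exists_acyclicFrom
      exact ⟨F.precomp (𝟙 X ≫ a), (isAcyclic_iff _).2 ⟨Z, 0, hZ, acyclicFrom_precomp hF (hE X).1⟩,
        rfl, fun k => hU k⟩

/-- `AcyclicFrom` peels a sequence from the left and `Res` from the right, so the part already
traversed is accumulated as a resolution of `A`. -/
lemma AcyclicFrom.res {n m : ℕ} {F : ComposableArrows C n} {A : C} {a : A ⟶ F.obj 0}
    (h : E.AcyclicFrom F a) (hU : ∀ k : Fin n, U (F.obj k.castSucc)) (hA : E.Res U m A) :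
    E.Res U (m + n) (F.obj (Fin.last n)) := by
  induction n generalizing A m with
  | zero =>
    obtain ⟨Z, hZ, h⟩ := h
    have := h.isIso_left hZ
    exact hA.of_iso (asIso a)
  | succ n ih =>
    obtain ⟨A', p, a', h, -, hF⟩ := h
    have := ih (m := m + 1) hF (fun k => hU k.succ) ⟨_, _, a, p, h, hU 0, hA⟩
    rwa [Nat.add_right_comm, Nat.add_assoc] at this

lemma Res.resolved {n m N : ℕ} {F : ComposableArrows C m} {A : C} {a : A ⟶ F.obj 0}
    (hA : E.Res U n A) (h : E.AcyclicFrom F a) (hU : ∀ k : Fin m, U (F.obj k.castSucc))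
    (hN : N = n + m) : E.resolved U N (F.obj (Fin.last m)) := by
  induction n generalizing A m with
  | zero =>
    obtain rfl : N = m := by omega
    exact ⟨F, (isAcyclic_iff F).2 ⟨A, a, hA, h⟩, rfl, hU⟩
  | succ n ih =>
    obtain ⟨X', V, i, p, hc, hV, hX⟩ := hA
    refine ih (m := m + 1) hX (acyclicFrom_precomp h hc) (fun k => ?_) (by omega)
    induction k using Fin.cases with
    | zero => exact hV
    | succ k => exact hU k

lemma resolved_iff (hE : E.HasTrivialConflations) (n : ℕ) (X : C) :
    E.resolved U n X ↔ E.Res U n X := by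
  obtain ⟨Z, hZ, hE⟩ := hE
  constructor
  · rintro ⟨F, hF, rfl, hU⟩
    obtain ⟨A, a, hA, hF⟩ := (isAcyclic_iff F).1 hF
    have := hF.res (m := 0) hU hA
    rwa [Nat.zero_add] at this
  · intro h
    exact h.resolved (F := .mk₀ X) (a := 𝟙 X) ⟨Z, hZ, (hE X).2⟩ (fun k => k.elim0) rfl

variable {P : ObjectProperty C}

lemma conf_restrict_iff {X Y Z : P.FullSubcategory} (i : X ⟶ Y) (p : Y ⟶ Z) :
    (E.restrict P).Conf i p ↔ E.Conf i.hom p.hom :=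
  ⟨fun ⟨w, h⟩ => ⟨congrArg (fun t => t.hom) w, h⟩, fun ⟨w, h⟩ => ⟨by ext; exact w, h⟩⟩

lemma isZero_fullSubcategory_iff (X : P.FullSubcategory) : IsZero X ↔ IsZero X.obj := by
  rw [IsZero.iff_id_eq_zero, IsZero.iff_id_eq_zero]
  exact ⟨fun h => congrArg (fun t => t.hom) h, fun h => by ext; exact h⟩

lemma cores_restrict_iff (n : ℕ) (X : P.FullSubcategory) :
    (E.restrict P).Cores (U.inverseImage P.ι) n X ↔ E.CoresIn P U n X.obj := by
  induction n generalizing X with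
  | zero => exact ⟨fun h => ⟨X.2, (isZero_fullSubcategory_iff X).1 h⟩,
      fun h => (isZero_fullSubcategory_iff X).2 h.2⟩
  | succ n ih =>
    constructor
    · rintro ⟨V, X', i, p, h, hV, hX⟩
      exact ⟨X.2, V.obj, X'.obj, i.hom, p.hom, (conf_restrict_iff i p).1 h, hV, V.2, (ih _).1 hX⟩
    · rintro ⟨-, V, X', i, p, h, hV, hV', hX⟩
      exact ⟨⟨V, hV'⟩, ⟨X', hX.prop⟩, ObjectProperty.homMk i, ObjectProperty.homMk p,
        (conf_restrict_iff _ _).2 h, hV, (ih ⟨X', hX.prop⟩).2 hX⟩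

lemma res_restrict_iff (n : ℕ) (X : P.FullSubcategory) :
    (E.restrict P).Res (U.inverseImage P.ι) n X ↔ E.ResIn P U n X.obj := by
  induction n generalizing X with
  | zero => exact ⟨fun h => ⟨X.2, (isZero_fullSubcategory_iff X).1 h⟩,
      fun h => (isZero_fullSubcategory_iff X).2 h.2⟩
  | succ n ih =>
    constructor
    · rintro ⟨X', V, i, p, h, hV, hX⟩
      exact ⟨X.2, X'.obj, V.obj, i.hom, p.hom, (conf_restrict_iff i p).1 h, hV, V.2, (ih _).1 hX⟩
    · rintro ⟨-, X', V, i, p, h, hV, hV', hX⟩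
      exact ⟨⟨X', hX.prop⟩, ⟨V, hV'⟩, ObjectProperty.homMk i, ObjectProperty.homMk p,
        (conf_restrict_iff _ _).2 h, hV, (ih ⟨X', hX.prop⟩).2 hX⟩

lemma HasTrivialConflations.restrict (hE : E.HasTrivialConflations)
    (hP : ∀ Z : C, IsZero Z → P Z) : (E.restrict P).HasTrivialConflations := by
  obtain ⟨Z, hZ, hE⟩ := hE
  exact ⟨⟨Z, hP Z hZ⟩, (isZero_fullSubcategory_iff _).2 hZ, fun X =>
    ⟨(conf_restrict_iff _ _).2 (hE X.obj).1, (conf_restrict_iff _ _).2 (hE X.obj).2⟩⟩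

lemma coresolvedIn_iff (hE : E.HasTrivialConflations) (hP : ∀ Z : C, IsZero Z → P Z) (n : ℕ)
    (X : C) : E.coresolvedIn P U n X ↔ E.CoresIn P U n X := by
  rw [coresolvedIn, ObjectProperty.strictMap_iff]
  constructor
  · rintro ⟨X, hX, rfl⟩
    exact (cores_restrict_iff n X).1 ((coresolved_iff (hE.restrict hP) n X).1 hX)
  · intro hX
    exact ⟨⟨X, hX.prop⟩, (coresolved_iff (hE.restrict hP) n _).2 ((cores_restrict_iff n _).2 hX), rfl⟩

lemma resolvedIn_iff (hE : E.HasTrivialConflations) (hP : ∀ Z : C, IsZero Z → P Z) (n : ℕ)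
    (X : C) : E.resolvedIn P U n X ↔ E.ResIn P U n X := by
  rw [resolvedIn, ObjectProperty.strictMap_iff]
  constructor
  · rintro ⟨X, hX, rfl⟩
    exact (res_restrict_iff n X).1 ((resolved_iff (hE.restrict hP) n X).1 hX)
  · intro hX
    exact ⟨⟨X, hX.prop⟩, (resolved_iff (hE.restrict hP) n _).2 ((res_restrict_iff n _).2 hX), rfl⟩

end ConflationStructure

/-! ### From vanishing of Yoneda `Ext` to one-sided triviality -/

namespace ConflationStructure

variable {C : Type u} [Category.{v} C]

lemma comp_eq_comp_of_mono {R R' X Q K F : C} {x : R ⟶ X} {p : X ⟶ K} {a : K ⟶ F} [Mono a]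
    {p' : R ⟶ Q} {q : Q ⟶ K} {b : Q ⟶ R'} {u : R' ⟶ F} {m : R ⟶ R'} (hm : m = p' ≫ b)
    (hq : q ≫ a = b ≫ u) (hu : m ≫ u = x ≫ p ≫ a) : x ≫ p = p' ≫ q := by
  rw [← cancel_mono a, Category.assoc, ← hu, hm, Category.assoc, Category.assoc, hq]

lemma comp_inv_comp_eq_id {X Y Z : C} {f : X ⟶ Y} {r : Y ≅ Z} {e : X ≅ Z}
    (h : f ≫ r.hom = e.hom) : (r.hom ≫ e.inv) ≫ f = 𝟙 Y := by
  rw [← cancel_mono r.hom]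
  simp [h]

lemma comp_id_comp_eq {R Y X : C} {f e : R ⟶ Y} (h : f ≫ 𝟙 Y = e) (i : Y ⟶ X) :
    f ≫ 𝟙 Y ≫ i = e ≫ i := by
  simp [← h]

lemma inv_comp_eq_id {Q V W : C} {b : Q ⟶ W} [IsIso b] {s : V ⟶ W} {f : W ⟶ V}
    (h : s ≫ f = 𝟙 V) : (s ≫ inv b) ≫ b ≫ f = 𝟙 V := by
  simp [h]

variable [Preadditive C] {E : ConflationStructure C}

/-- The difference `x - t ≫ i` vanishes on the image `A` of `R₀`, so it descends to `Q`; modulo `Y`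
it still induces `q`. -/
lemma Conf.exists_lift {Z R₀ A R Q X K Y : C} {i : Y ⟶ X} {p : X ⟶ K} (h : E.Conf i p)
    {a : A ⟶ R} {p' : R ⟶ Q} (h' : E.Conf a p') {m : R₀ ⟶ R} {a₀ : Z ⟶ R₀}
    {p₀ : R₀ ⟶ A} (h₀ : E.Conf a₀ p₀)
    (hm : m = p₀ ≫ a) {y : R₀ ⟶ Y} {x : R ⟶ X} {t : R ⟶ Y} {q : Q ⟶ K} (hx : x ≫ p = p' ≫ q)
    (hi : m ≫ x = y ≫ i) (ht : m ≫ t = y) : ∃ l : Q ⟶ X, l ≫ p = q := by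
  subst hm
  rw [Category.assoc] at hi ht
  have := h₀.epi
  obtain ⟨l, hl⟩ := h'.desc (x - t ≫ i) (by
    rw [← cancel_epi p₀, Preadditive.comp_sub, Preadditive.comp_sub, hi, reassoc_of% ht]
    simp)
  have := h'.epi
  refine ⟨l, ?_⟩
  rw [← cancel_epi p', reassoc_of% hl, Preadditive.sub_comp, Category.assoc, h.zero, comp_zero,
    sub_zero, hx]

lemma Chain.exists_arrows (hE : E.HasTrivialConflations) {V : C} {n : ℕ} {Y : C}
    (S : E.Chain V n Y) :
    ∃ (F : ComposableArrows C n) (a : Y ⟶ F.obj 0) (_ : F.obj (Fin.last n) ≅ V),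
      E.AcyclicFrom F a ∧ ∀ ⦃Q : C⦄ (G : ComposableArrows C n) (b : Q ⟶ G.obj 0),
        E.AcyclicFrom G b → ∀ φ : G ⟶ F, (∃ s, s ≫ φ.app (Fin.last n) = 𝟙 _) →
          ∃ q : Q ⟶ Y, q ≫ a = b ≫ φ.app 0 ∧ S.LiftsAlong q := by
  induction S with
  | nil =>
    obtain ⟨Z, hZ, hE⟩ := hE
    refine ⟨.mk₀ V, 𝟙 V, Iso.refl _, ⟨Z, hZ, (hE V).2⟩, ?_⟩
    rintro Q G b ⟨Z', hZ', hb⟩ φ ⟨s, hs⟩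
    have := hb.isIso_left hZ'
    exact ⟨b ≫ φ.app 0, Category.comp_id _, s ≫ inv b,
      inv_comp_eq_id hs⟩
  | @cons n Y X K i p h S ih =>
    obtain ⟨F, a, r, hF, hS⟩ := ih
    refine ⟨F.precomp (p ≫ a), i, r, acyclicFrom_precomp hF h, ?_⟩
    rintro Q G b ⟨Q', p', b', hb, hG, hG'⟩ φ hφ
    obtain ⟨q', hq', hSq'⟩ := hS G.δ₀ b' hG' (ComposableArrows.δ₀Functor.map φ) hφ
    let x : G.obj 0 ⟶ X := φ.app 0
    have hx : p' ≫ q' = x ≫ p := by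
      have := hF.mono
      have nat : G.map' 0 1 ≫ φ.app 1 = x ≫ p ≫ a := φ.naturality (homOfLE (Fin.zero_le 1))
      exact (comp_eq_comp_of_mono hG hq' nat).symm
    obtain ⟨q, hq⟩ := h.lift (b ≫ x) (by rw [Category.assoc, ← hx, reassoc_of% hb.zero, zero_comp])
    exact ⟨q, hq, G.obj 0, Q', b, p', x, q', hb, hq.symm, hx, hSq'⟩

end ConflationStructure

namespace ExactStructure

open ConflationStructure

variable {C : Type u} [Category.{v} C] [Preadditive C] (E : ExactStructure C)

lemma hasTrivialConflations [HasZeroObject C] : E.HasTrivialConflations := by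
  obtain ⟨Z, hZ⟩ := HasZeroObject.zero (C := C)
  exact ⟨Z, hZ, fun X => ⟨conf_zero_id hZ, conf_id_zero hZ⟩⟩

variable {E} [HasZeroObject C]

lemma exists_chain (V : C) (n : ℕ) : ∃ K : C, Nonempty (E.Chain V n K) := by
  obtain ⟨Z, hZ⟩ := HasZeroObject.zero (C := C)
  induction n with
  | zero => exact ⟨V, ⟨.nil⟩⟩
  | succ n ih =>
    obtain ⟨K, ⟨S⟩⟩ := ih
    exact ⟨Z, ⟨.cons _ _ (conf_zero_id hZ) S⟩⟩

variable [HasBinaryBiproducts C]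

omit [HasZeroObject C] in
lemma comp_fst_eq {R R' Y K : C} {m : R ⟶ R'} {t : R' ⟶ Y ⊞ K} {y : R ⟶ Y}
    (h : m ≫ t = y ≫ biprod.inl) : m ≫ t ≫ biprod.fst = y := by
  rw [reassoc_of% h]
  simp

lemma leftVanishes_of_extVanishes {n : ℕ} {V Y : C} (hVY : E.ExtVanishes (n + 1) V Y) :
    E.LeftVanishes n V Y := by
  intro X K i p h S
  have hE := E.hasTrivialConflations
  obtain ⟨F, a, r, hF, hS⟩ := S.exists_arrows hE
  -- The given extension is compared with one whose first map is the split inclusion of `Y` into `Y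
  -- ⊞ K'`. Through the roof `R` the projection to `Y` becomes the map `t` of `Conf.exists_lift`.
  obtain ⟨K', ⟨S'⟩⟩ := exists_chain (E := E) V n
  obtain ⟨F', a', r', hF', -⟩ := S'.exists_arrows hE
  obtain ⟨Z, hZ, hE⟩ := hE
  have h' := conf_inl_snd (E := E) Y K'
  obtain ⟨R, φ, ψ, ⟨hφ₀, hφ₁⟩, ⟨hψ₀, hψ₁⟩⟩ := hVY
    { seq := (F.precomp (p ≫ a)).precomp (𝟙 Y ≫ i)
      isAcyclic := (isAcyclic_iff _).2
        ⟨Z, 0, hZ, acyclicFrom_precomp (acyclicFrom_precomp hF h) (hE Y).1⟩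
      leftIso := Iso.refl _
      rightIso := r }
    { seq := (F'.precomp (biprod.snd ≫ a')).precomp (𝟙 Y ≫ biprod.inl)
      isAcyclic := (isAcyclic_iff _).2
        ⟨Z, 0, hZ, acyclicFrom_precomp (acyclicFrom_precomp hF' h') (hE Y).1⟩
      leftIso := Iso.refl _
      rightIso := r' }
  obtain ⟨A, a₀, hA, A', p₀, a₁, h₀, hm₀, Q, p₁, a₂, h₁, hm₁, hR⟩ := (isAcyclic_iff _).1 R.isAcyclic
  have := h₀.epi
  obtain ⟨q, hq, hSq⟩ := hS R.seq.δ₀.δ₀ a₂ hR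
    (ComposableArrows.δ₀Functor.map (ComposableArrows.δ₀Functor.map φ))
    ⟨r.hom ≫ R.rightIso.inv, comp_inv_comp_eq_id hφ₁⟩
  have := hF.mono
  let x : R.seq.δ₀.obj 0 ⟶ X := φ.app 1
  let t : R.seq.δ₀.obj 0 ⟶ Y ⊞ K' := ψ.app 1
  have nat₁ : R.seq.map' 0 1 ≫ x = φ.app 0 ≫ 𝟙 Y ≫ i := φ.naturality (homOfLE (Fin.zero_le 1))
  have nat₂ : R.seq.δ₀.map' 0 1 ≫ φ.app 2 = x ≫ p ≫ a :=
    (ComposableArrows.δ₀Functor.map φ).naturality (homOfLE (Fin.zero_le 1))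
  have nat₃ : R.seq.map' 0 1 ≫ t = ψ.app 0 ≫ 𝟙 Y ≫ biprod.inl :=
    ψ.naturality (homOfLE (Fin.zero_le 1))
  obtain ⟨l, hl⟩ := h.exists_lift h₁ h₀ hm₀ (y := R.leftIso.hom) (q := q) (x := x)
    (t := t ≫ biprod.fst) (comp_eq_comp_of_mono hm₁ hq nat₂)
    (nat₁.trans (comp_id_comp_eq hφ₀ i)) (comp_fst_eq (nat₃.trans (comp_id_comp_eq hψ₀ _)))
  exact ⟨Q, l, by rwa [hl]⟩

variable {U : ObjectProperty C} {d : ℕ}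

/-- For a `d`-rigid additive subcategory `U`, coresolving within the resolved objects and resolving
within the coresolved objects give the same objects. -/
lemma resolvedIn_coresolved_eq (hd : 1 ≤ d) (hU : IsClosedUnderDirectSums U)
    (hext : E.IsRigid d U) :
    E.resolvedIn (E.coresolved U d) U d = E.coresolvedIn (E.resolved U d) U d := by
  have hE := E.hasTrivialConflations
  have hs : E.SplitsBelow U d := splitsBelow_of_leftVanishes fun n hn V Y hV hY =>
    leftVanishes_of_extVanishes (hext (n + 1) (by omega) hn V Y hV hY)
  have h₁ : E.coresolved U d = E.Cores U d := by
    ext X; exact coresolved_iff hE d X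
  have h₂ : E.resolved U d = E.Res U d := by
    ext X; exact resolved_iff hE d X
  ext X
  rw [h₁, h₂, resolvedIn_iff hE fun Z hZ => (cores_iff_opposite _ _).2
    (res_of_isZero (E := E.opposite) hU.opposite d hZ.op), coresolvedIn_iff hE fun Z hZ => res_of_isZero hU d hZ]
  exact ⟨coresIn_of_resIn hU hs hd, resIn_of_coresIn hU hs hd⟩

end ExactStructure

theorem corollary4p8 {C : Type u} [Category.{v} C] [Preadditive C] [HasZeroObject C]
    [HasBinaryBiproducts C] (E : ExactStructure C) (d : ℕ) (hd : 1 ≤ d)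
    (U : ObjectProperty C) (hU : IsClosedUnderDirectSums U) (hext : E.IsExtensionClosed d U) :
    E.resolvedIn (E.coresolved U d) U d = E.coresolvedIn (E.resolved U d) U d :=
  ExactStructure.resolvedIn_coresolved_eq hd hU hext.1
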